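/- For $x\in\mathbb R$ and $\delta>0$ let $$q_{\min}(x,\delta)=\min\Big\{q\in\mathbb N=\{1,2,\dots\}:\ \exists\,p\in\mathbb Z,\ \tfrac pq\in\big(x-\tfrac\delta2,\,x+\tfrac\delta2\big)\Big\}.$$ For $t>0$ put $$F(t)=\begin{cases}1 & t\ge 1,\\ -1+2t-2t\log t & \tfrac14\le t\le 1,\\ -1+2t+2\sqrt{\tfrac14-t}-4t\log\big(\tfrac12+\sqrt{\tfrac14-t}\big) & 0<t\le\tfrac14,\end{cases}$$ let $H(s)=F\big((\tfrac{\pi^2}{3}s)^{-1}\big)$ for $s>0$, $H(0)=1$ (the Hall distribution), and let $\eta(s)=\tfrac{6}{\pi^2}\,s\,H\big(\tfrac{3}{\pi^2}s^2\big)$ for $s\ge 0$. **Proposition.** Let $\mathcal D\subset[0,1]$ be an interval (open, closed or half-open, possibly degenerate). Then for every $\alpha\in\mathbb C$ with $|\operatorname{Re}\alpha|<2$: * for every $\delta>0$ the function $x\mapsto q_{\min}(x,\delta)^\alpha$ is Lebesgue integrable over $\mathcal D$; * the integral $M(\alpha)=\int_0^\infty s^\alpha\,\eta(s)\,ds$ converges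 absolutely; * $$\lim_{\delta\to0^+}\delta^{\alpha/2}\int_{\mathcal D}q_{\min}(x,\delta)^\alpha\,dx=\operatorname{vol}\mathcal D\cdot M(\alpha).$$ Moreover $M(1)=16/\pi^2$ (the constant in the Chen–Haynes asymptotics for the expectation of $q_{\min}$). -/

import Mathlib

open MeasureTheory Set Filter Topology

noncomputable section

/-- The positive integers `q` that are the denominator of some fraction `p / q` (not necessarily
in lowest terms) in the open interval `(x - δ/2, x + δ/2)`. -/
def denominators (x δ : ℝ) : Set ℕ :=
  {q : ℕ | 0 < q ∧ ∃ p : ℤ, (p : ℝ) / (q : ℝ) ∈ Ioo (x - δ / 2) (x + δ / 2)}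

/-- The smallest denominator of all fractions in the interval of length `δ` centred at `x`.
The minimum is attained whenever `δ > 0`, see `isLeast_qMin`. -/
def qMin (x δ : ℝ) : ℕ := sInf (denominators x δ)

/-- For `δ > 0` the infimum in `qMin` is a genuine minimum. -/
theorem isLeast_qMin (x : ℝ) {δ : ℝ} (hδ : 0 < δ) : IsLeast (denominators x δ) (qMin x δ) := by
  have hne : (denominators x δ).Nonempty := by
    obtain ⟨r, h1, h2⟩ := exists_rat_btwn (show x - δ / 2 < x + δ / 2 by linarith)
    refine ⟨r.den, r.pos, r.num, ?_⟩
    rw [← Rat.cast_def]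
    exact ⟨h1, h2⟩
  exact ⟨Nat.sInf_mem hne, fun q hq => Nat.sInf_le hq⟩

/-- The right-hand side of the explicit formula for the Hall distribution, as a function of the
variable `t > 0`. -/
def hallF (t : ℝ) : ℝ :=
  if 1 ≤ t then 1
  else if 1 / 4 ≤ t then -1 + 2 * t - 2 * t * Real.log t
  else -1 + 2 * t + 2 * Real.sqrt (1 / 4 - t)
    - 4 * t * Real.log (1 / 2 + Real.sqrt (1 / 4 - t))

/-- The Hall distribution `H(s) = F(t)` with `t = (π² s / 3)⁻¹`, for `s ≥ 0`. The value at `s = 0`,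
where `t = ∞`, is `1`. -/
def hallH (s : ℝ) : ℝ :=
  if s ≤ 0 then 1 else hallF ((Real.pi ^ 2 / 3 * s)⁻¹)

/-- The limit density `η(s) = (6/π²) s H((3/π²) s²)` on `[0, ∞)`. -/
def eta (s : ℝ) : ℝ :=
  6 / Real.pi ^ 2 * s * hallH (3 / Real.pi ^ 2 * s ^ 2)

/-- The moments `M(α) = ∫₀^∞ s^α η(s) ds` for complex `α`. -/
def momentM (α : ℂ) : ℂ :=
  ∫ s in Ioi (0 : ℝ), (s : ℂ) ^ α * (eta s : ℂ)

end

/-!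
Write `δ = s² / R²`. Then `√δ * qMin x δ > s` says that `x` has distance at least `δ / 2` from all
fractions of denominator at most `R`. The gaps of the Farey sequence of order `R` in `(0, 1)`
correspond to the coprime pairs `q, q' ≤ R` with `q + q' > R`, the gap having length `1 / (q q')`,
so the measure of these `x ∈ (0, 1)` is `∑ max (1 / (q q') - δ) 0` (`volume_fareyFree`). In
layer-cake form this is an integral over `v > s` of `2 v / R²` times the number of pairs with
`q q' < R² / v²`. Primitive lattice points are equidistributed with density `6 / π²`, by Möbius
inversion (`tendsto_card_coprimePairs`), and `hallF t` is twice the area of the part `a b < t` of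
the Farey triangle (`hallF_eq_volume`); hence the limit is `∫_s^∞ η` (`tendsto_volume_largeSet`).
The same sum gives the uniform bounds `8 / s²` for large and `1 - s²` for small `s`.

To pass from `(0, 1)` to a subinterval no estimate of Kloosterman sums is needed. A unimodular
fractional linear map `g u = (a u + b) / (c u + d)` multiplies denominators by about `c u + d` and
distances by about `(c u + d)⁻²`, which leaves `√δ * qMin` unchanged as long as `c u + d` is nearly
constant (`qMin_moebius_le`, `le_qMin_moebius`). On `[j, j + 1]` it varies by a factor
`1 + O(1 / j)`, and there the law of `qMin` is that on `(0, 1)` by periodicity. So the limit law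
holds on `g [j, j + 1]` up to a relative error that is small for large `j`
(`exists_forall_eventually_discrepancy_le`). Every Farey interval `g [0, ∞]` splits into Farey
intervals such that those with large `j` fill a fixed proportion
(`DiscrepancyBound.eventually_le`). Hence the best constant `θ` in "discrepancy at most `θ` times
the length, on all Farey intervals" can be improved as long as it is positive, so it is `0`
(`discrepancyBound_zero`). Farey intervals generate the intervals with rational end points, and
these approximate all others (`tendsto_volume_inter_largeSet`).

Finally `y ^ α - 1 = ∫_1^y α s ^ (α - 1) ds` expresses the moments through the tails
(`integral_cpow_eq`), and the tail bounds allow dominated convergence for `|Re α| < 2`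
(`tendsto_integral_signedTail`). For `α = 1` Fubini reduces the moment to the integral of
`(ab)^{-3/2}` over the Farey triangle, which is `4` (`momentM_one`).
-/

/-! ### Lattice points in the Farey triangle -/

/-- The Farey triangle `{(a, b) ∈ (0, 1]² : a + b > 1}`, cut off by the hyperbola `a b = t`.
The positivity of `a` and `b` follows from the other inequalities. -/
def cutTriangle (t : ℝ) : Set (ℝ × ℝ) :=
  {z | z.1 ≤ 1 ∧ z.2 ≤ 1 ∧ 1 < z.1 + z.2 ∧ z.1 * z.2 < t}

/-- The integer points of the dilated region `R • cutTriangle t`. -/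
noncomputable def latticePairs (R t : ℝ) : Finset (ℕ × ℕ) := by
  classical
  exact (Finset.Icc 1 ⌊R⌋₊ ×ˢ Finset.Icc 1 ⌊R⌋₊).filter
    fun z => R < (z.1 : ℝ) + z.2 ∧ (z.1 : ℝ) * z.2 < t * R ^ 2

/-- The primitive integer points of the dilated region `R • cutTriangle t`. -/
noncomputable def coprimePairs (R t : ℝ) : Finset (ℕ × ℕ) :=
  (latticePairs R t).filter fun z => Nat.Coprime z.1 z.2

theorem mem_latticePairs {R t : ℝ} (hR : 0 ≤ R) {z : ℕ × ℕ} :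
    z ∈ latticePairs R t ↔ (z.1 : ℝ) ≤ R ∧ (z.2 : ℝ) ≤ R ∧ R < (z.1 : ℝ) + z.2 ∧
      (z.1 : ℝ) * z.2 < t * R ^ 2 := by
  simp only [latticePairs, Finset.mem_filter, Finset.mem_product, Finset.mem_Icc,
    Nat.le_floor_iff hR]
  constructor
  · rintro ⟨⟨⟨h1, h2⟩, h3, h4⟩, h5, h6⟩
    exact ⟨h2, h4, h5, h6⟩
  · rintro ⟨h2, h4, h5, h6⟩
    refine ⟨⟨⟨?_, h2⟩, ?_, h4⟩, h5, h6⟩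
    · rcases Nat.eq_zero_or_pos z.1 with h | h
      · rw [h] at h5; push_cast at h5; linarith
      · exact h
    · rcases Nat.eq_zero_or_pos z.2 with h | h
      · rw [h] at h5; push_cast at h5; linarith
      · exact h

theorem pos_of_mem_latticePairs {R t : ℝ} {z : ℕ × ℕ} (h : z ∈ latticePairs R t) :
    0 < z.1 ∧ 0 < z.2 := by
  simp only [latticePairs, Finset.mem_filter, Finset.mem_product, Finset.mem_Icc] at h
  omega

theorem measurableSet_cutTriangle (t : ℝ) : MeasurableSet (cutTriangle t) := by
  have h : cutTriangle t = {z : ℝ × ℝ | z.1 ≤ 1} ∩ ({z | z.2 ≤ 1} ∩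
      ({z | 1 < z.1 + z.2} ∩ {z | z.1 * z.2 < t})) := rfl
  rw [h]
  refine (measurableSet_le (by fun_prop) (by fun_prop)).inter <|
    (measurableSet_le (by fun_prop) (by fun_prop)).inter <|
    (measurableSet_lt (by fun_prop) (by fun_prop)).inter <|
    measurableSet_lt (by fun_prop) (by fun_prop)

theorem cutTriangle_subset (t : ℝ) : cutTriangle t ⊆ Ioc 0 1 ×ˢ Ioc 0 1 := by
  rintro ⟨a, b⟩ ⟨h1, h2, h3, -⟩
  simp only [mem_prod, mem_Ioc] at *
  exact ⟨⟨by linarith, h1⟩, by linarith, h2⟩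

theorem volume_cutTriangle_le_one (t : ℝ) : volume (cutTriangle t) ≤ 1 := by
  refine (measure_mono (cutTriangle_subset t)).trans ?_
  rw [Measure.volume_eq_prod, Measure.prod_prod]
  simp

theorem volume_cutTriangle_ne_top (t : ℝ) : volume (cutTriangle t) ≠ ⊤ :=
  ((volume_cutTriangle_le_one t).trans_lt ENNReal.one_lt_top).ne

/-- The union of the squares of side `1 / R` whose upper right corner is a point of
`cutTriangle t` with coordinates in `(1 / R) ℤ`. -/
def roundedTriangle (R t : ℝ) : Set (ℝ × ℝ) :=
  {z | ((⌈R * z.1⌉₊ : ℝ) / R, (⌈R * z.2⌉₊ : ℝ) / R) ∈ cutTriangle t}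

theorem measurableSet_roundedTriangle (R t : ℝ) : MeasurableSet (roundedTriangle R t) := by
  refine measurableSet_preimage ?_ (measurableSet_cutTriangle t)
  have h : ∀ f : ℝ × ℝ → ℝ, Measurable f → Measurable fun z => (⌈f z⌉₊ : ℝ) / R := fun f hf =>
    ((measurable_from_top (f := fun n : ℕ => (n : ℝ))).comp
      (Nat.measurable_ceil.comp hf)).div_const R
  exact (h _ (by fun_prop)).prodMk (h _ (by fun_prop))

theorem mem_latticePairs_iff_cutTriangle {R t : ℝ} (hR : 0 < R) {m n : ℕ} :
    (m, n) ∈ latticePairs R t ↔ ((m : ℝ) / R, (n : ℝ) / R) ∈ cutTriangle t := by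
  rw [mem_latticePairs hR.le]
  simp only [cutTriangle, mem_ofPred_eq]
  rw [div_le_one hR, div_le_one hR, ← add_div, one_lt_div hR, div_mul_div_comm,
    div_lt_iff₀ (by positivity), ← sq]

theorem roundedTriangle_eq {R : ℝ} (hR : 0 < R) (t : ℝ) :
    roundedTriangle R t = ⋃ p ∈ latticePairs R t,
      Ioc (((p.1 : ℝ) - 1) / R) (p.1 / R) ×ˢ Ioc (((p.2 : ℝ) - 1) / R) (p.2 / R) := by
  have key : ∀ (n : ℕ) (x : ℝ), 0 < n → (x ∈ Ioc (((n : ℝ) - 1) / R) (n / R) ↔ ⌈R * x⌉₊ = n) := by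
    intro n x hn
    rw [Nat.ceil_eq_iff hn.ne', mem_Ioc, div_lt_iff₀ hR, le_div_iff₀ hR, Nat.cast_sub hn,
      Nat.cast_one, mul_comm x R]
  ext ⟨x, y⟩
  simp only [mem_iUnion, exists_prop, mem_prod]
  constructor
  · intro h
    have h1 : (⌈R * x⌉₊, ⌈R * y⌉₊) ∈ latticePairs R t := (mem_latticePairs_iff_cutTriangle hR).2 h
    obtain ⟨h2, h3⟩ := pos_of_mem_latticePairs h1
    exact ⟨_, h1, (key _ _ h2).2 rfl, (key _ _ h3).2 rfl⟩
  · rintro ⟨⟨m, n⟩, h1, h2, h3⟩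
    obtain ⟨h4, h5⟩ := pos_of_mem_latticePairs h1
    rw [key _ _ h4] at h2
    rw [key _ _ h5] at h3
    simp only [roundedTriangle, mem_ofPred_eq]
    rw [h2, h3]
    exact (mem_latticePairs_iff_cutTriangle hR).1 h1

theorem volume_roundedTriangle {R : ℝ} (hR : 0 < R) (t : ℝ) :
    volume (roundedTriangle R t) = ENNReal.ofReal ((latticePairs R t).card / R ^ 2) := by
  rw [roundedTriangle_eq hR, measure_biUnion_finset]
  · have : ∀ p ∈ latticePairs R t, volume (Ioc (((p.1 : ℝ) - 1) / R) (p.1 / R) ×ˢ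
        Ioc (((p.2 : ℝ) - 1) / R) (p.2 / R)) = ENNReal.ofReal (1 / R ^ 2) := by
      intro p _
      rw [Measure.volume_eq_prod, Measure.prod_prod, Real.volume_Ioc, Real.volume_Ioc,
        ← ENNReal.ofReal_mul]
      · congr 1; field_simp; ring
      · rw [← sub_div]; apply div_nonneg _ hR.le; linarith
    rw [Finset.sum_congr rfl this, Finset.sum_const, nsmul_eq_mul, ← ENNReal.ofReal_natCast,
      ← ENNReal.ofReal_mul (by positivity)]
    congr 1; ring
  · intro p hp q hq hpq
    rw [Function.onFun, Set.disjoint_left]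
    rintro ⟨x, y⟩ ⟨h1, h2⟩ ⟨h3, h4⟩
    apply hpq
    have key : ∀ (m n : ℕ) (x : ℝ), x ∈ Ioc (((n : ℝ) - 1) / R) (n / R) →
        x ∈ Ioc (((m : ℝ) - 1) / R) (m / R) → m ≤ n := by
      intro m n x h h'
      have := h'.1.trans_le h.2
      rw [div_lt_div_iff_of_pos_right hR, sub_lt_iff_lt_add] at this
      exact Nat.lt_succ_iff.1 (by exact_mod_cast this)
    simp only at h1 h2 h3 h4
    exact Prod.ext (le_antisymm (key _ _ _ h3 h1) (key _ _ _ h1 h3))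
      (le_antisymm (key _ _ _ h4 h2) (key _ _ _ h2 h4))
  · exact fun p _ => measurableSet_Ioc.prod measurableSet_Ioc

theorem tendsto_ceil_mul_div (x : ℝ) (hx : 0 < x) :
    Tendsto (fun R : ℝ => (⌈R * x⌉₊ : ℝ) / R) atTop (𝓝 x) := by
  have h := (tendsto_nat_ceil_div_atTop (R := ℝ)).comp (tendsto_id.atTop_mul_const hx)
  have h2 := h.mul_const x
  rw [one_mul] at h2
  refine h2.congr' ?_
  filter_upwards [eventually_gt_atTop 0] with R hR
  simp only [Function.comp, id]
  field_simp

theorem ae_fst_ne (c : ℝ) : ∀ᵐ z : ℝ × ℝ, z.1 ≠ c := by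
  rw [ae_iff]
  have : {z : ℝ × ℝ | ¬ z.1 ≠ c} = {c} ×ˢ univ := by ext; simp
  rw [this, Measure.volume_eq_prod, Measure.prod_prod]; simp

theorem ae_snd_ne (c : ℝ) : ∀ᵐ z : ℝ × ℝ, z.2 ≠ c := by
  rw [ae_iff]
  have : {z : ℝ × ℝ | ¬ z.2 ≠ c} = univ ×ˢ {c} := by ext; simp
  rw [this, Measure.volume_eq_prod, Measure.prod_prod]; simp

theorem ae_fst_add_snd_ne (c : ℝ) : ∀ᵐ z : ℝ × ℝ, z.1 + z.2 ≠ c := by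
  rw [Measure.volume_eq_prod]
  have hm : MeasurableSet {z : ℝ × ℝ | z.1 + z.2 = c} :=
    measurableSet_eq_fun (by fun_prop) (by fun_prop)
  rw [ae_iff]
  simp only [ne_eq, not_not]
  rw [Measure.measure_prod_null hm]
  refine Eventually.of_forall fun x => ?_
  have : Prod.mk x ⁻¹' {z : ℝ × ℝ | z.1 + z.2 = c} = {c - x} := by
    ext y; simp; constructor <;> intro h <;> linarith
  simp [this]

/-- The number of integer points in `R • cutTriangle t` is asymptotic to the area. -/
theorem tendsto_card_latticePairs (t : ℝ) :
    Tendsto (fun R : ℝ => ((latticePairs R t).card : ℝ) / R ^ 2) atTop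
      (𝓝 (volume (cutTriangle t)).toReal) := by
  have hsub : ∀ R : ℝ, 0 < R → ∀ z ∈ roundedTriangle R t, 0 < z.1 ∧ 0 < z.2 := by
    intro R hR z hz
    obtain ⟨h1, h2⟩ := pos_of_mem_latticePairs ((mem_latticePairs_iff_cutTriangle hR).2 hz)
    rw [Nat.ceil_pos] at h1 h2
    exact ⟨(mul_pos_iff_of_pos_left hR).1 h1, (mul_pos_iff_of_pos_left hR).1 h2⟩
  have hle : ∀ R : ℝ, 0 < R → ∀ x : ℝ, x ≤ (⌈R * x⌉₊ : ℝ) / R := by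
    intro R hR x
    rw [le_div_iff₀ hR, mul_comm]; exact Nat.le_ceil _
  have h : Tendsto (fun R : ℝ => volume (roundedTriangle R t)) atTop
      (𝓝 (volume (cutTriangle t))) := by
    refine tendsto_measure_of_ae_tendsto_indicator (B := Icc 0 1 ×ˢ Icc 0 1) atTop
      (measurableSet_cutTriangle t) (fun R => measurableSet_roundedTriangle R t)
      (measurableSet_Icc.prod measurableSet_Icc) ?_ ?_ ?_
    · rw [Measure.volume_eq_prod, Measure.prod_prod]; simp
    · filter_upwards [eventually_gt_atTop 0] with R hR z hz
      obtain ⟨h1, h2⟩ := hsub R hR z hz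
      exact ⟨⟨h1.le, (hle R hR _).trans hz.1⟩, h2.le, (hle R hR _).trans hz.2.1⟩
    · filter_upwards [ae_fst_ne 1, ae_snd_ne 1, ae_fst_add_snd_ne 1] with z h1 h2 h3
      by_cases hz : 0 < z.1 ∧ 0 < z.2
      swap
      · filter_upwards [eventually_gt_atTop 0] with R hR
        refine iff_of_false (fun h => hz (hsub R hR z h)) fun h => hz ?_
        exact ⟨(cutTriangle_subset t h).1.1, (cutTriangle_subset t h).2.1⟩
      obtain ⟨hz1, hz2⟩ := hz
      have l1 := tendsto_ceil_mul_div z.1 hz1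
      have l2 := tendsto_ceil_mul_div z.2 hz2
      by_cases hT : z ∈ cutTriangle t
      · have e1 := l1.eventually_le_const (lt_of_le_of_ne hT.1 h1)
        have e2 := l2.eventually_le_const (lt_of_le_of_ne hT.2.1 h2)
        have e3 := (l1.add l2).eventually_const_lt hT.2.2.1
        have e4 := (l1.mul l2).eventually_lt_const hT.2.2.2
        filter_upwards [e1, e2, e3, e4] with R a b c d
        exact iff_of_true ⟨a, b, c, d⟩ hT
      · by_cases h4 : z.1 + z.2 < 1
        · filter_upwards [(l1.add l2).eventually_lt_const h4] with R hR
          exact iff_of_false (fun h => absurd h.2.2.1 (not_lt.2 hR.le)) hT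
        · have h4' : 1 < z.1 + z.2 := lt_of_le_of_ne (not_lt.1 h4) (Ne.symm h3)
          filter_upwards [eventually_gt_atTop 0] with R hR
          refine iff_of_false (fun h => hT ?_) hT
          refine ⟨(hle R hR _).trans h.1, (hle R hR _).trans h.2.1, h4', ?_⟩
          exact (mul_le_mul (hle R hR _) (hle R hR _) hz2.le (by positivity)).trans_lt h.2.2.2
  have h2 := (ENNReal.tendsto_toReal (volume_cutTriangle_ne_top t)).comp h
  refine h2.congr' ?_
  filter_upwards [eventually_gt_atTop 0] with R hR
  simp only [Function.comp]
  rw [volume_roundedTriangle hR, ENNReal.toReal_ofReal (by positivity)]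

/-! ### Primitive lattice points -/

theorem sum_moebius_divisors (n : ℕ) :
    ∑ d ∈ n.divisors, ArithmeticFunction.moebius d = if n = 1 then 1 else 0 := by
  rw [← ArithmeticFunction.coe_zeta_mul_apply, ArithmeticFunction.coe_zeta_mul_moebius,
    ArithmeticFunction.one_apply]

theorem card_latticePairs_filter_dvd {R : ℝ} (hR : 0 ≤ R) (t : ℝ) {d : ℕ} (hd : 0 < d) :
    ((latticePairs R t).filter fun z => d ∣ z.1 ∧ d ∣ z.2).card =
      (latticePairs (R / d) t).card := by
  have hd' : (0 : ℝ) < d := by exact_mod_cast hd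
  have key : ∀ m n : ℕ, (d * m, d * n) ∈ latticePairs R t ↔ (m, n) ∈ latticePairs (R / d) t := by
    intro m n
    rw [mem_latticePairs hR, mem_latticePairs (by positivity)]
    push_cast
    rw [le_div_iff₀ hd', le_div_iff₀ hd', div_lt_iff₀ hd', ← mul_add, mul_comm (d : ℝ),
      mul_comm (d : ℝ), mul_comm (d : ℝ) (_ + _)]
    have : (m * d * (n * d) : ℝ) < t * R ^ 2 ↔ (m * n : ℝ) < t * (R / d) ^ 2 := by
      rw [div_pow, mul_div_assoc', lt_div_iff₀ (by positivity)]
      constructor <;> intro h <;> nlinarith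
    rw [this]
  symm
  refine Finset.card_bij (fun z _ => (d * z.1, d * z.2)) ?_ ?_ ?_
  · rintro ⟨m, n⟩ h
    simp only [Finset.mem_filter]
    exact ⟨(key m n).2 h, dvd_mul_right _ _, dvd_mul_right _ _⟩
  · rintro ⟨m, n⟩ _ ⟨m', n'⟩ _ h
    simp only [Prod.mk.injEq, Nat.mul_right_inj hd.ne'] at h
    exact Prod.ext h.1 h.2
  · rintro ⟨a, b⟩ h
    simp only [Finset.mem_filter] at h
    obtain ⟨h, ⟨m, rfl⟩, n, rfl⟩ := h
    exact ⟨(m, n), (key m n).1 h, rfl⟩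

/-- Möbius inversion for the number of primitive points; the points divisible by `d` are `d` times
the points of the region dilated by `R / d`. -/
theorem card_coprimePairs_eq {R : ℝ} (hR : 0 ≤ R) (t : ℝ) :
    ((coprimePairs R t).card : ℤ) = ∑ d ∈ Finset.Icc 1 ⌊R⌋₊,
      ArithmeticFunction.moebius d * ((latticePairs (R / d) t).card : ℤ) := by
  have h1 : ∀ z ∈ latticePairs R t, (if Nat.Coprime z.1 z.2 then (1 : ℤ) else 0) =
      ∑ d ∈ Finset.Icc 1 ⌊R⌋₊, if d ∣ z.1 ∧ d ∣ z.2 then ArithmeticFunction.moebius d else 0 := by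
    intro z hz
    have hp := pos_of_mem_latticePairs hz
    have hz' := (mem_latticePairs hR).1 hz
    have hgcd : (if Nat.Coprime z.1 z.2 then (1 : ℤ) else 0) =
        if Nat.gcd z.1 z.2 = 1 then 1 else 0 := if_congr Iff.rfl rfl rfl
    rw [← Finset.sum_filter, hgcd, ← sum_moebius_divisors]
    refine Finset.sum_congr ?_ fun _ _ => rfl
    ext d
    simp only [Nat.mem_divisors, Finset.mem_filter, Finset.mem_Icc, Nat.dvd_gcd_iff]
    constructor
    · rintro ⟨h, -⟩
      exact ⟨⟨Nat.pos_of_dvd_of_pos h.1 hp.1,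
        (Nat.le_of_dvd hp.1 h.1).trans (Nat.le_floor hz'.1)⟩, h⟩
    · rintro ⟨-, h⟩
      exact ⟨h, (Nat.gcd_pos_of_pos_left _ hp.1).ne'⟩
  rw [coprimePairs, Finset.card_filter]
  push_cast
  rw [Finset.sum_congr rfl h1, Finset.sum_comm]
  refine Finset.sum_congr rfl fun d hd => ?_
  rw [← card_latticePairs_filter_dvd hR t (Finset.mem_Icc.1 hd).1, ← Finset.sum_filter,
    Finset.sum_const, nsmul_eq_mul, mul_comm]

theorem card_latticePairs_le_sq {R : ℝ} (hR : 0 ≤ R) (t : ℝ) :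
    ((latticePairs R t).card : ℝ) ≤ R ^ 2 := by
  have h : (latticePairs R t).card ≤ ⌊R⌋₊ * ⌊R⌋₊ := by
    refine (Finset.card_filter_le _ _).trans ?_
    rw [Finset.card_product]; simp
  have h2 := Nat.floor_le hR
  calc ((latticePairs R t).card : ℝ) ≤ ⌊R⌋₊ * ⌊R⌋₊ := by exact_mod_cast h
    _ ≤ R ^ 2 := by rw [sq]; gcongr

theorem hasSum_moebius_div_sq :
    HasSum (fun d : ℕ => (ArithmeticFunction.moebius d : ℝ) / (d : ℝ) ^ 2) (6 / Real.pi ^ 2) := by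
  have h2 : (1 : ℝ) < (2 : ℂ).re := by norm_num
  have hs := (ArithmeticFunction.LSeriesSummable_moebius_iff (s := 2)).2 h2
  have hv := ArithmeticFunction.LSeries_zeta_mul_Lseries_moebius h2
  rw [ArithmeticFunction.LSeries_zeta_eq_riemannZeta h2, riemannZeta_two] at hv
  have h3 := hs.hasSum
  rw [← Complex.hasSum_ofReal]
  have hpi : (Real.pi : ℂ) ≠ 0 := by exact_mod_cast Real.pi_ne_zero
  have h4 : ∑' n, LSeries.term (fun n => ((ArithmeticFunction.moebius n : ℤ) : ℂ)) 2 n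
      = ((6 / Real.pi ^ 2 : ℝ) : ℂ) := by
    have : LSeries (fun n => ((ArithmeticFunction.moebius n : ℤ) : ℂ)) 2 = 6 / Real.pi ^ 2 := by
      field_simp at hv ⊢
      linear_combination hv
    rw [LSeries] at this
    rw [this]; push_cast; rfl
  rw [← h4]
  convert h3 using 2 with n
  rcases eq_or_ne n 0 with rfl | hn
  · simp
  · rw [LSeries.term_of_ne_zero hn]
    push_cast
    norm_cast

/-- The number of primitive integer points in `R • cutTriangle t`. -/
theorem tendsto_card_coprimePairs (t : ℝ) :
    Tendsto (fun R : ℝ => ((coprimePairs R t).card : ℝ) / R ^ 2) atTop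
      (𝓝 (6 / Real.pi ^ 2 * (volume (cutTriangle t)).toReal)) := by
  set A := (volume (cutTriangle t)).toReal
  have hlim : Tendsto (fun R : ℝ => ∑' d : ℕ, (ArithmeticFunction.moebius d : ℝ) *
      ((latticePairs (R / d) t).card / R ^ 2)) atTop
      (𝓝 (∑' d : ℕ, (ArithmeticFunction.moebius d : ℝ) / (d : ℝ) ^ 2 * A)) := by
    refine tendsto_tsum_of_dominated_convergence (bound := fun d : ℕ => 1 / (d : ℝ) ^ 2)
      (Real.summable_one_div_nat_pow.2 (by norm_num)) ?_ ?_
    · intro d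
      rcases Nat.eq_zero_or_pos d with rfl | hd
      · simp
      have hd' : (0 : ℝ) < d := by exact_mod_cast hd
      have h := (tendsto_card_latticePairs t).comp (tendsto_id.atTop_div_const hd')
      have h' := h.const_mul ((ArithmeticFunction.moebius d : ℝ) / (d : ℝ) ^ 2)
      refine h'.congr' ?_
      filter_upwards [eventually_gt_atTop 0] with R hR
      simp only [Function.comp, id]
      field_simp
    · filter_upwards [eventually_gt_atTop 0] with R hR d
      rcases Nat.eq_zero_or_pos d with rfl | hd
      · simp
      have hd' : (0 : ℝ) < d := by exact_mod_cast hd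
      have hmu : |(ArithmeticFunction.moebius d : ℝ)| ≤ 1 := by
        exact_mod_cast ArithmeticFunction.abs_moebius_le_one (n := d)
      have h1 := card_latticePairs_le_sq (R := R / d) (by positivity) t
      rw [Real.norm_eq_abs, abs_mul, abs_of_nonneg (a := _ / R ^ 2) (by positivity)]
      calc _ ≤ 1 * ((R / d) ^ 2 / R ^ 2) := by gcongr
        _ = _ := by field_simp
  rw [tsum_mul_right, hasSum_moebius_div_sq.tsum_eq] at hlim
  refine hlim.congr' ?_
  filter_upwards [eventually_gt_atTop 0] with R hR
  have hC : ((coprimePairs R t).card : ℝ) = ∑ d ∈ Finset.Icc 1 ⌊R⌋₊,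
      (ArithmeticFunction.moebius d : ℝ) * (latticePairs (R / d) t).card := by
    exact_mod_cast card_coprimePairs_eq hR.le t
  rw [hC, Finset.sum_div, tsum_eq_sum (s := Finset.Icc 1 ⌊R⌋₊)]
  · exact Finset.sum_congr rfl fun d _ => by ring
  · intro d hd
    rcases Nat.eq_zero_or_pos d with rfl | hd0
    · simp
    have hd' : (0 : ℝ) < d := by exact_mod_cast hd0
    have hlt : R < d := by
      rw [Finset.mem_Icc, not_and, not_le] at hd
      exact (Nat.floor_lt hR.le).1 (hd hd0)
    have : latticePairs (R / d) t = ∅ := by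
      have : ⌊R / d⌋₊ = 0 := Nat.floor_eq_zero.2 ((div_lt_one hd').2 hlt)
      simp [latticePairs, this]
    simp [this]

/-- If `q q' < t R²` and `q + q' > R` then one of `q`, `q'` is less than `2 t R`, and given this
one, at most as many values are left for the other. -/
theorem card_latticePairs_le {R t : ℝ} (hR : 0 < R) :
    ((latticePairs R t).card : ℝ) ≤ 8 * t ^ 2 * R ^ 2 := by
  classical
  rcases le_or_gt t 0 with ht | ht
  · have : latticePairs R t = ∅ := by
      refine Finset.eq_empty_of_forall_notMem fun z hz => ?_
      have := ((mem_latticePairs hR.le).1 hz).2.2.2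
      have : t * R ^ 2 ≤ 0 := mul_nonpos_of_nonpos_of_nonneg ht (by positivity)
      have : (0 : ℝ) ≤ z.1 * z.2 := by positivity
      linarith
    rw [this]; simp; positivity
  set K := ⌊2 * t * R⌋₊
  set S : Finset ((_ : ℕ) × ℕ) := (Finset.Icc 1 K).sigma fun q => Finset.Ioc (⌊R⌋₊ - q) ⌊R⌋₊
  have hK : (K : ℝ) ≤ 2 * t * R := Nat.floor_le (by positivity)
  have hS : (S.card : ℝ) ≤ K * K := by
    rw [Finset.card_sigma]
    push_cast
    calc ∑ q ∈ Finset.Icc 1 K, ((Finset.Ioc (⌊R⌋₊ - q) ⌊R⌋₊).card : ℝ)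
        ≤ ∑ q ∈ Finset.Icc 1 K, (K : ℝ) := by
          refine Finset.sum_le_sum fun q hq => ?_
          rw [Nat.card_Ioc]
          have := (Finset.mem_Icc.1 hq).2
          exact_mod_cast (by omega : ⌊R⌋₊ - (⌊R⌋₊ - q) ≤ K)
      _ = K * K := by simp
  have key : ∀ m n : ℕ, (n : ℝ) ≤ R → R < (m : ℝ) + n → (m : ℝ) * n < t * R ^ 2 → m ≤ n →
      (⟨m, n⟩ : (_ : ℕ) × ℕ) ∈ S := by
    intro m n h1 h2 h3 h4
    have h4' : (m : ℝ) ≤ n := by exact_mod_cast h4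
    have h5 : R / 2 < n := by linarith
    have hm : 0 < m := by
      rcases Nat.eq_zero_or_pos m with rfl | h
      · push_cast at h2; linarith
      · exact h
    have h6 : (m : ℝ) ≤ 2 * t * R := by
      by_contra h
      push Not at h
      have : 2 * t * R * (R / 2) ≤ m * n := by gcongr
      nlinarith
    have h7 : ⌊R⌋₊ < m + n := (Nat.floor_lt hR.le).2 (by push_cast; exact h2)
    simp only [S, Finset.mem_sigma, Finset.mem_Icc, Finset.mem_Ioc]
    exact ⟨⟨hm, Nat.le_floor h6⟩, by omega, Nat.le_floor h1⟩
  have hsub : latticePairs R t ⊆ S.image (fun x => (x.1, x.2)) ∪ S.image (fun x => (x.2, x.1)) := by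
    rintro ⟨m, n⟩ h
    obtain ⟨h1, h2, h3, h4⟩ := (mem_latticePairs hR.le).1 h
    simp only at h1 h2 h3 h4
    rw [Finset.mem_union, Finset.mem_image, Finset.mem_image]
    rcases le_total m n with h5 | h5
    · exact Or.inl ⟨_, key m n h2 h3 h4 h5, rfl⟩
    · exact Or.inr ⟨_, key n m h1 (by linarith) (by linarith) h5, rfl⟩
  have hcard : (latticePairs R t).card ≤ S.card + S.card :=
    (Finset.card_le_card hsub).trans <| (Finset.card_union_le _ _).trans <|
      add_le_add Finset.card_image_le Finset.card_image_le
  calc ((latticePairs R t).card : ℝ) ≤ S.card + S.card := by exact_mod_cast hcard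
    _ ≤ 2 * (K * K) := by linarith
    _ ≤ 2 * ((2 * t * R) * (2 * t * R)) := by gcongr
    _ = _ := by ring

theorem card_coprimePairs_le {R t : ℝ} (hR : 0 < R) :
    ((coprimePairs R t).card : ℝ) ≤ 8 * t ^ 2 * R ^ 2 :=
  le_trans (by exact_mod_cast Finset.card_filter_le _ _) (card_latticePairs_le hR)

theorem volume_cutTriangle_le (t : ℝ) : (volume (cutTriangle t)).toReal ≤ 8 * t ^ 2 := by
  refine le_of_tendsto (tendsto_card_latticePairs t) ?_
  filter_upwards [eventually_gt_atTop 0] with R hR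
  rw [div_le_iff₀ (by positivity)]
  exact card_latticePairs_le hR

/-! ### Gaps of the Farey sequence -/

theorem exists_bezout_of_coprime {q q' : ℕ} (hq : 0 < q) (hq' : 0 < q') (h : Nat.Coprime q q') :
    ∃ p p' : ℤ, p' * q - p * q' = 1 ∧ 0 ≤ p ∧ p < q ∧ p' ≤ q' := by
  have hb := Nat.gcd_eq_gcd_ab q q'
  rw [h.gcd_eq_one] at hb
  set y := Nat.gcdB q q'
  have hq0 : (0 : ℤ) < q := by exact_mod_cast hq
  have hq0' : (0 : ℤ) < q' := by exact_mod_cast hq'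
  have h1 := Int.emod_add_mul_ediv (-y) q
  have h2 := Int.emod_nonneg (-y) hq0.ne'
  have h3 := Int.emod_lt_of_pos (-y) hq0
  push_cast at hb
  set p := (-y) % q
  refine ⟨p, Nat.gcdA q q' - q' * (-y / q), ?_, h2, h3, ?_⟩
  · linear_combination -hb - q' * h1
  · by_contra hlt
    push Not at hlt
    have e : (Nat.gcdA q q' - q' * (-y / q)) * q = p * q' + 1 := by
      linear_combination -hb - q' * h1
    nlinarith

/-- A fraction strictly between the Farey neighbours `p / q` and `p' / q'` has denominator at
least `q + q'`. -/
theorem add_le_den_of_between {p p' m : ℤ} {q q' n : ℕ} (hq : 0 < q) (hq' : 0 < q') (hn : 0 < n)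
    (h : p' * q - p * q' = 1) (h1 : (p : ℝ) / q < m / n) (h2 : (m : ℝ) / n < p' / q') :
    q + q' ≤ n := by
  have hq0 : (0 : ℝ) < q := by exact_mod_cast hq
  have hq0' : (0 : ℝ) < q' := by exact_mod_cast hq'
  have hn0 : (0 : ℝ) < n := by exact_mod_cast hn
  rw [div_lt_div_iff₀ hq0 hn0] at h1
  rw [div_lt_div_iff₀ hn0 hq0'] at h2
  have h1' : p * n < m * q := by exact_mod_cast h1
  have h2' : m * q' < p' * n := by exact_mod_cast h2
  have e : (n : ℤ) = (m * q - p * n) * q' + (p' * n - m * q') * q := by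
    linear_combination (-(n : ℤ)) * h
  have a1 : (q' : ℤ) ≤ (m * q - p * n) * q' := le_mul_of_one_le_left (by positivity) (by omega)
  have a2 : (q : ℤ) ≤ (p' * n - m * q') * q := le_mul_of_one_le_left (by positivity) (by omega)
  omega

/-- Every irrational number lies between two Farey neighbours of order `Q`: passing from `Q` to
`Q + 1` at most inserts the mediant. -/
theorem exists_farey_neighbours {x : ℝ} (hx : Irrational x) (Q : ℕ) (hQ : 1 ≤ Q) :
    ∃ (p p' : ℤ) (q q' : ℕ), 0 < q ∧ 0 < q' ∧ q ≤ Q ∧ q' ≤ Q ∧ Q < q + q' ∧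
      p' * q - p * q' = 1 ∧ (p : ℝ) / q < x ∧ x < p' / q' := by
  induction Q, hQ using Nat.le_induction with
  | base =>
    refine ⟨⌊x⌋, ⌊x⌋ + 1, 1, 1, one_pos, one_pos, le_rfl, le_rfl, by norm_num, by push_cast; ring,
      ?_, ?_⟩
    · have := Int.floor_le x
      have h2 : x ≠ ⌊x⌋ := hx.ne_int _
      simpa using lt_of_le_of_ne this h2.symm
    · simp
  | succ Q hQ ih =>
    obtain ⟨p, p', q, q', hq, hq', h1, h2, h3, h4, h5, h6⟩ := ih
    by_cases h : Q + 1 < q + q'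
    · exact ⟨p, p', q, q', hq, hq', by omega, by omega, h, h4, h5, h6⟩
    have hs : q + q' = Q + 1 := by omega
    have hne : x ≠ ((p + p' : ℤ) : ℝ) / ((q + q' : ℕ) : ℝ) := by
      intro he
      apply hx
      exact ⟨(p + p' : ℤ) / (q + q' : ℕ), by rw [he]; push_cast; ring⟩
    rcases lt_or_gt_of_ne hne with hlt | hgt
    · refine ⟨p, p + p', q, q + q', hq, by omega, by omega, by omega, by omega, ?_, h5, hlt⟩
      push_cast; linear_combination h4
    · refine ⟨p + p', p', q + q', q', by omega, hq', by omega, by omega, by omega, ?_, hgt, h6⟩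
      push_cast; linear_combination h4

/-- The points at distance at least `δ / 2` from all fractions of denominator at most `R`. -/
def fareyFree (R δ : ℝ) : Set ℝ :=
  {x | ∀ q : ℕ, 0 < q → (q : ℝ) ≤ R → ∀ p : ℤ, (p : ℝ) / q ∉ Ioo (x - δ / 2) (x + δ / 2)}

theorem mem_fareyFree_iff_lt_qMin {R δ x : ℝ} (hδ : 0 < δ) :
    x ∈ fareyFree R δ ↔ R < qMin x δ := by
  obtain ⟨⟨h0, p, hp⟩, hl⟩ := isLeast_qMin x hδ
  constructor
  · intro h
    by_contra hlt
    exact h _ h0 (not_lt.1 hlt) p hp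
  · intro h q hq hqR m hm
    have := hl ⟨hq, m, hm⟩
    have : (qMin x δ : ℝ) ≤ q := by exact_mod_cast this
    linarith

theorem isClosed_fareyFree (R δ : ℝ) : IsClosed (fareyFree R δ) := by
  have : fareyFree R δ = ⋂ q : ℕ, ⋂ (_ : 0 < q), ⋂ (_ : (q : ℝ) ≤ R), ⋂ p : ℤ,
      {x : ℝ | (p : ℝ) / q ∈ Ioo (x - δ / 2) (x + δ / 2)}ᶜ := by
    ext x; simp [fareyFree]
  rw [this]
  refine isClosed_iInter fun q => isClosed_iInter fun _ => isClosed_iInter fun _ =>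
    isClosed_iInter fun p => IsOpen.isClosed_compl ?_
  exact (isOpen_lt (f := fun x : ℝ => x - δ / 2) (by fun_prop) continuous_const).inter
    (isOpen_lt (g := fun x : ℝ => x + δ / 2) continuous_const (by fun_prop))

/-- In the Farey gap between `p / q` and `p' / q'`, of length `1 / (q q')`, the set `fareyFree R δ`
is what is left after removing a piece of length `δ / 2` at each end. -/
theorem volume_fareyFree_inter_gap {R δ : ℝ} (hδ : 0 ≤ δ) {p p' : ℤ} {q q' : ℕ}
    (hq : 0 < q) (hq' : 0 < q') (h : p' * q - p * q' = 1) (h1 : (q : ℝ) ≤ R) (h2 : (q' : ℝ) ≤ R)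
    (h3 : R < (q : ℝ) + q') :
    volume (Ioo ((p : ℝ) / q) (p' / q') ∩ fareyFree R δ) =
      ENNReal.ofReal (1 / ((q : ℝ) * q') - δ) := by
  have hq0 : (0 : ℝ) < q := by exact_mod_cast hq
  have hq0' : (0 : ℝ) < q' := by exact_mod_cast hq'
  have hlen : (p' : ℝ) / q' - p / q = 1 / ((q : ℝ) * q') := by
    have h' : (p' : ℝ) * q - p * q' = 1 := by exact_mod_cast h
    field_simp; linarith
  have hlen2 : (p' : ℝ) / q' - δ / 2 - (p / q + δ / 2) = 1 / ((q : ℝ) * q') - δ := by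
    rw [← hlen]; ring
  apply le_antisymm
  · rw [← hlen2, ← Real.volume_Icc]
    refine measure_mono ?_
    rintro x ⟨⟨hx1, hx2⟩, hx⟩
    constructor
    · by_contra hc
      exact hx q hq h1 p ⟨by linarith, by linarith⟩
    · by_contra hc
      exact hx q' hq' h2 p' ⟨by linarith, by linarith⟩
  · rw [← hlen2, ← Real.volume_Ioo]
    refine measure_mono ?_
    rintro x ⟨hx1, hx2⟩
    refine ⟨⟨by linarith, by linarith⟩, ?_⟩
    rintro n hn hnR m ⟨hm1, hm2⟩
    have := add_le_den_of_between (m := m) hq hq' hn h (by linarith) (by linarith)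
    have : (q : ℝ) + q' ≤ n := by exact_mod_cast this
    linarith

/-- For `t = 2` the condition `q q' < t R²` is void. -/
theorem mem_coprimePairs_two {R : ℝ} (hR : 0 < R) {z : ℕ × ℕ} : z ∈ coprimePairs R 2 ↔
    (z.1 : ℝ) ≤ R ∧ (z.2 : ℝ) ≤ R ∧ R < (z.1 : ℝ) + z.2 ∧ Nat.Coprime z.1 z.2 := by
  rw [coprimePairs, Finset.mem_filter, mem_latticePairs hR.le]
  constructor
  · tauto
  · rintro ⟨h1, h2, h3, h4⟩
    refine ⟨⟨h1, h2, h3, ?_⟩, h4⟩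
    have : (z.1 : ℝ) * z.2 ≤ R * R := by gcongr
    nlinarith

theorem coprimePairs_eq_filter {R : ℝ} (hR : 0 < R) (t : ℝ) : coprimePairs R t =
    (coprimePairs R 2).filter fun z => (z.1 : ℝ) * z.2 < t * R ^ 2 := by
  ext z
  rw [Finset.mem_filter, mem_coprimePairs_two hR, coprimePairs, Finset.mem_filter,
    mem_latticePairs hR.le]
  tauto

/-- The gaps of the Farey sequence of order `R` in `(0, 1)` are in bijection with the pairs of
coprime denominators `q, q' ≤ R` with `q + q' > R`. -/
theorem volume_fareyFree {R δ : ℝ} (hR : 1 ≤ R) (hδ : 0 ≤ δ) :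
    volume (Ioo 0 1 ∩ fareyFree R δ) =
      ∑ z ∈ coprimePairs R 2, ENNReal.ofReal (1 / ((z.1 : ℝ) * z.2) - δ) := by
  have hR0 : 0 < R := by linarith
  have hex : ∀ z : ℕ × ℕ, z ∈ coprimePairs R 2 →
      ∃ p p' : ℤ, p' * z.1 - p * z.2 = 1 ∧ 0 ≤ p ∧ p < z.1 ∧ p' ≤ z.2 := by
    intro z hz
    obtain ⟨h1, h2⟩ := pos_of_mem_latticePairs (Finset.mem_filter.1 hz).1
    exact exists_bezout_of_coprime h1 h2 (Finset.mem_filter.1 hz).2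
  choose! p p' hdet hp0 hp1 hp2 using hex
  -- The gap whose end points have the denominators `z.1` and `z.2`.
  set I : ℕ × ℕ → Set ℝ := fun z => Ioo ((p z : ℝ) / z.1) (p' z / z.2)
  have hpos : ∀ z ∈ coprimePairs R 2, 0 < z.1 ∧ 0 < z.2 := fun z hz =>
    pos_of_mem_latticePairs (Finset.mem_filter.1 hz).1
  have hsub : ∀ z ∈ coprimePairs R 2, I z ⊆ Ioo 0 1 := by
    intro z hz
    obtain ⟨h1, h2⟩ := hpos z hz
    have h1' : (0 : ℝ) < z.1 := by exact_mod_cast h1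
    have h2' : (0 : ℝ) < z.2 := by exact_mod_cast h2
    refine Ioo_subset_Ioo ?_ ?_
    · have : (0 : ℝ) ≤ p z := by exact_mod_cast hp0 z hz
      positivity
    · rw [div_le_one h2']; exact_mod_cast hp2 z hz
  have hcov : ∀ x : ℝ, Irrational x → x ∈ Ioo (0 : ℝ) 1 → ∃ z ∈ coprimePairs R 2, x ∈ I z := by
    intro x hx hx01
    obtain ⟨r, r', q, q', hq, hq', h1, h2, h3, h4, h5, h6⟩ :=
      exists_farey_neighbours hx ⌊R⌋₊ (Nat.one_le_floor_iff R |>.2 hR)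
    have hq0 : (0 : ℝ) < q := by exact_mod_cast hq
    have hq0' : (0 : ℝ) < q' := by exact_mod_cast hq'
    have hcop : Nat.Coprime q q' := by
      rw [← Nat.isCoprime_iff_coprime]
      exact ⟨r', -r, by linear_combination h4⟩
    have hz : (q, q') ∈ coprimePairs R 2 := by
      rw [mem_coprimePairs_two hR0]
      refine ⟨(Nat.le_floor_iff hR0.le).1 h1, (Nat.le_floor_iff hR0.le).1 h2, ?_, hcop⟩
      have := (Nat.floor_lt hR0.le).1 h3
      push_cast at this; exact this
    have d1 := hdet _ hz
    have d2 := hp0 _ hz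
    have d3 := hp1 _ hz
    simp only at d1 d2 d3
    have hr1 : r < q := by
      have : (r : ℝ) < q := (div_lt_one hq0).1 (h5.trans hx01.2)
      exact_mod_cast this
    have hr0 : 0 ≤ r := by
      have : (0 : ℝ) < r' / q' := hx01.1.trans h6
      have : (0 : ℝ) < r' := by rwa [div_pos_iff_of_pos_right hq0'] at this
      have h7 : 0 < r' := by exact_mod_cast this
      have h8 : (0 : ℤ) < q := by exact_mod_cast hq
      have h9 : (0 : ℤ) < q' := by exact_mod_cast hq'
      by_contra hneg
      push Not at hneg
      nlinarith
    have hdvd : (q : ℤ) ∣ (r - p (q, q')) := by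
      have : (q : ℤ) ∣ (r - p (q, q')) * q' := ⟨r' - p' (q, q'), by linear_combination d1 - h4⟩
      exact ((Nat.isCoprime_iff_coprime).2 hcop).dvd_of_dvd_mul_right this
    have hr : r = p (q, q') := by
      have := Int.eq_zero_of_abs_lt_dvd hdvd (by rw [abs_lt]; constructor <;> linarith)
      linarith
    have hr' : r' = p' (q, q') := by
      have h8 : (q : ℤ) ≠ 0 := by exact_mod_cast hq.ne'
      apply mul_right_cancel₀ h8
      rw [hr] at h4
      linear_combination h4 - d1
    exact ⟨_, hz, by simpa [I, ← hr] using h5, by simpa [I, ← hr'] using h6⟩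
  -- An end point of one gap inside another gap would have too large a denominator, so overlapping
  -- gaps have the same end points, and their denominators agree since fractions are reduced.
  have hdisj : ∀ z ∈ coprimePairs R 2, ∀ w ∈ coprimePairs R 2, ∀ x, x ∈ I z → x ∈ I w → z = w := by
    have hle : ∀ z ∈ coprimePairs R 2, ∀ w ∈ coprimePairs R 2, ∀ x, x ∈ I z → x ∈ I w →
        (p w : ℝ) / w.1 ≤ p z / z.1 ∧ (p' z : ℝ) / z.2 ≤ p' w / w.2 := by
      intro z hz w hw x hxz hxw
      obtain ⟨a1, a2⟩ := hpos z hz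
      obtain ⟨b1, b2⟩ := hpos w hw
      have hz3 := ((mem_coprimePairs_two hR0).1 hz).2.2.1
      have hw3 := (mem_coprimePairs_two hR0).1 hw
      constructor
      · by_contra hlt
        have := add_le_den_of_between a1 a2 b1 (hdet z hz) (not_le.1 hlt) (hxw.1.trans hxz.2)
        have : (z.1 : ℝ) + z.2 ≤ w.1 := by exact_mod_cast this
        linarith [hw3.1]
      · by_contra hlt
        have := add_le_den_of_between a1 a2 b2 (hdet z hz) (hxz.1.trans hxw.2) (not_le.1 hlt)
        have : (z.1 : ℝ) + z.2 ≤ w.2 := by exact_mod_cast this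
        linarith [hw3.2.1]
    have hden : ∀ (a b : ℤ) (m n : ℕ), 0 < m → 0 < n → IsCoprime a m → IsCoprime b n →
        (a : ℝ) / m = b / n → m = n := by
      intro a b m n hm hn h1 h2 h
      have hm0 : (m : ℝ) ≠ 0 := by exact_mod_cast hm.ne'
      have hn0 : (n : ℝ) ≠ 0 := by exact_mod_cast hn.ne'
      rw [div_eq_div_iff hm0 hn0] at h
      have h' : a * n = b * m := by exact_mod_cast h
      apply Nat.dvd_antisymm
      · have : (m : ℤ) ∣ a * n := ⟨b, by rw [h']; ring⟩
        exact_mod_cast h1.symm.dvd_of_dvd_mul_left this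
      · have : (n : ℤ) ∣ b * m := ⟨a, by rw [← h']; ring⟩
        exact_mod_cast h2.symm.dvd_of_dvd_mul_left this
    intro z hz w hw x hxz hxw
    obtain ⟨a1, a2⟩ := hpos z hz
    obtain ⟨b1, b2⟩ := hpos w hw
    obtain ⟨l1, l2⟩ := hle z hz w hw x hxz hxw
    obtain ⟨l3, l4⟩ := hle w hw z hz x hxw hxz
    have c : ∀ z ∈ coprimePairs R 2, IsCoprime (p z) (z.1 : ℤ) ∧ IsCoprime (p' z) (z.2 : ℤ) :=
      fun z hz => ⟨⟨-z.2, p' z, by linear_combination hdet z hz⟩,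
        ⟨z.1, -p z, by linear_combination hdet z hz⟩⟩
    exact Prod.ext (hden _ _ _ _ a1 b1 (c z hz).1 (c w hw).1 (le_antisymm l3 l1))
      (hden _ _ _ _ a2 b2 (c z hz).2 (c w hw).2 (le_antisymm l2 l4))
  have hirr : ∀ᵐ x : ℝ, Irrational x := by
    have : volume (Set.range ((↑) : ℚ → ℝ)) = 0 := (Set.countable_range _).measure_zero _
    exact measure_eq_zero_iff_ae_notMem.1 this
  have hae : volume (Ioo 0 1 ∩ fareyFree R δ) =
      volume (⋃ z ∈ coprimePairs R 2, (I z ∩ fareyFree R δ)) := by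
    refine measure_congr ?_
    filter_upwards [hirr] with x hx
    refine propext ⟨?_, ?_⟩
    · rintro ⟨h1, h2⟩
      obtain ⟨z, hz, hxz⟩ := hcov x hx h1
      exact mem_biUnion hz ⟨hxz, h2⟩
    · intro h
      obtain ⟨z, hz, h1, h2⟩ := mem_iUnion₂.1 h
      exact ⟨hsub z hz h1, h2⟩
  rw [hae, measure_biUnion_finset]
  · refine Finset.sum_congr rfl fun z hz => ?_
    obtain ⟨h1, h2⟩ := hpos z hz
    obtain ⟨h3, h4, h5, -⟩ := (mem_coprimePairs_two hR0).1 hz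
    exact volume_fareyFree_inter_gap hδ h1 h2 (hdet z hz) h3 h4 h5
  · intro z hz w hw hne
    rw [Function.onFun, Set.disjoint_left]
    rintro x ⟨h1, -⟩ ⟨h2, -⟩
    exact hne (hdisj z hz w hw x h1 h2)
  · exact fun z _ => measurableSet_Ioo.inter (isClosed_fareyFree R δ).measurableSet

/-! ### The Hall distribution as an area -/

theorem volume_cutTriangle_slice (t : ℝ) {a : ℝ} (ha : a ∈ Ioc (0 : ℝ) 1) :
    volume (Prod.mk a ⁻¹' cutTriangle t) = ENNReal.ofReal (min 1 (t / a) - 1 + a) := by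
  have ha0 : 0 < a := ha.1
  have h : ∀ b, b ∈ Prod.mk a ⁻¹' cutTriangle t ↔ b ≤ 1 ∧ 1 - a < b ∧ b < t / a := by
    intro b
    simp only [cutTriangle, mem_preimage, mem_ofPred_eq]
    rw [lt_div_iff₀ ha0, mul_comm b a]
    constructor
    · rintro ⟨-, h2, h3, h4⟩; exact ⟨h2, by linarith, h4⟩
    · rintro ⟨h2, h3, h4⟩; exact ⟨ha.2, h2, by linarith, h4⟩
  have e : min 1 (t / a) - 1 + a = min 1 (t / a) - (1 - a) := by ring
  apply le_antisymm
  · rw [e, ← Real.volume_Icc]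
    exact measure_mono fun b hb => by
      obtain ⟨h1, h2, h3⟩ := (h b).1 hb
      exact ⟨h2.le, le_min h1 h3.le⟩
  · rw [e, ← Real.volume_Ioo]
    exact measure_mono fun b hb => (h b).2
      ⟨hb.2.le.trans (min_le_left _ _), hb.1, hb.2.trans_le (min_le_right _ _)⟩

theorem cutTriangle_slice_eq_empty (t : ℝ) {a : ℝ} (ha : a ∉ Ioc (0 : ℝ) 1) :
    Prod.mk a ⁻¹' cutTriangle t = ∅ := by
  ext b
  simp only [mem_preimage, mem_empty_iff_false, iff_false]
  exact fun h => ha (cutTriangle_subset t h).1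

theorem volume_cutTriangle_toReal (t : ℝ) :
    (volume (cutTriangle t)).toReal = ∫ a in (0 : ℝ)..1, max (min 1 (t / a) - 1 + a) 0 := by
  rw [Measure.volume_eq_prod, Measure.prod_apply (measurableSet_cutTriangle t),
    intervalIntegral.integral_of_le zero_le_one,
    integral_eq_lintegral_of_nonneg_ae (f := fun a => max (min 1 (t / a) - 1 + a) 0)
      (Eventually.of_forall fun a => le_max_right _ _)
      (Measurable.aestronglyMeasurable (by fun_prop)),
    ← lintegral_indicator measurableSet_Ioc]
  congr 1
  refine lintegral_congr fun a => ?_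
  by_cases ha : a ∈ Ioc (0 : ℝ) 1
  · rw [indicator_of_mem ha, volume_cutTriangle_slice t ha]
    rcases le_total 0 (min 1 (t / a) - 1 + a) with h | h
    · rw [max_eq_left h]
    · rw [max_eq_right h, ENNReal.ofReal_of_nonpos h, ENNReal.ofReal_zero]
  · rw [indicator_of_notMem ha, cutTriangle_slice_eq_empty t ha, measure_empty]

theorem integral_slice_primitive (t : ℝ) {x y : ℝ} (hx : 0 < x) (hxy : x ≤ y) :
    ∫ a in x..y, (t / a - 1 + a) =
      (t * Real.log y - y + y ^ 2 / 2) - (t * Real.log x - x + x ^ 2 / 2) := by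
  have hpos : ∀ a ∈ uIcc x y, a ≠ 0 := by
    intro a ha
    rw [uIcc_of_le hxy] at ha
    exact (hx.trans_le ha.1).ne'
  refine intervalIntegral.integral_eq_sub_of_hasDerivAt
    (f := fun a => t * Real.log a - a + a ^ 2 / 2) ?_ ?_
  · intro a ha
    have h := (((Real.hasDerivAt_log (hpos a ha)).const_mul t).sub (hasDerivAt_id a)).add
      ((hasDerivAt_pow 2 a).div_const 2)
    refine h.congr_deriv ?_
    push_cast
    field_simp
  · apply ContinuousOn.intervalIntegrable
    exact ((continuousOn_const.div continuousOn_id hpos).sub continuousOn_const).add continuousOn_id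

theorem intervalIntegrable_slice (t : ℝ) {x y : ℝ} (hxy : x ≤ y)
    (hy : y ≤ 1) : IntervalIntegrable (fun a => max (min 1 (t / a) - 1 + a) 0) volume x y := by
  rw [intervalIntegrable_iff_integrableOn_Ioc_of_le hxy]
  refine Measure.integrableOn_of_bounded (M := 1) (by simp)
    (Measurable.aestronglyMeasurable (by fun_prop)) ?_
  filter_upwards [ae_restrict_mem measurableSet_Ioc] with a ha
  rw [Real.norm_eq_abs, abs_of_nonneg (le_max_right _ _)]
  refine max_le ?_ zero_le_one
  have := min_le_left 1 (t / a)
  linarith [ha.2]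

/-- The Hall distribution is the area of the part of the Farey triangle below a hyperbola,
normalised by the area `1 / 2` of the triangle. -/
theorem hallF_eq_volume {t : ℝ} (ht : 0 < t) :
    hallF t = 2 * (volume (cutTriangle t)).toReal := by
  rw [volume_cutTriangle_toReal]
  have hint := @intervalIntegrable_slice t
  have below : ∀ y : ℝ, 0 ≤ y → y ≤ t → y ≤ 1 →
      ∫ a in (0 : ℝ)..y, max (min 1 (t / a) - 1 + a) 0 = y ^ 2 / 2 := by
    intro y hy hyt hy1
    have : ∫ a in (0 : ℝ)..y, max (min 1 (t / a) - 1 + a) 0 = ∫ a in (0 : ℝ)..y, a := by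
      rw [intervalIntegral.integral_of_le hy, intervalIntegral.integral_of_le hy]
      refine setIntegral_congr_fun measurableSet_Ioc fun a ha => ?_
      have : 1 ≤ t / a := by rw [le_div_iff₀ ha.1]; linarith [ha.2]
      rw [min_eq_left this, max_eq_left (by linarith [ha.1])]; ring
    rw [this, integral_id]; ring
  have above : ∀ x y : ℝ, 0 < x → t ≤ x → x ≤ y → y ≤ 1 →
      (∀ a ∈ Icc x y, 0 ≤ a ^ 2 - a + t) →
      ∫ a in x..y, max (min 1 (t / a) - 1 + a) 0 =
        (t * Real.log y - y + y ^ 2 / 2) - (t * Real.log x - x + x ^ 2 / 2) := by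
    intro x y hx htx hxy hy1 hpos
    rw [← integral_slice_primitive t hx hxy]
    refine intervalIntegral.integral_congr fun a ha => ?_
    rw [uIcc_of_le hxy] at ha
    have ha0 : 0 < a := hx.trans_le ha.1
    have : t / a ≤ 1 := by rw [div_le_one ha0]; linarith [ha.1]
    have h2 : t / a - 1 + a = (a ^ 2 - a + t) / a := by field_simp; ring
    rw [min_eq_right this, max_eq_left]
    rw [h2]; exact div_nonneg (hpos a ha) ha0.le
  unfold hallF
  split_ifs with h1 h2
  · rw [below 1 zero_le_one h1 le_rfl]; norm_num
  · rw [not_le] at h1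
    rw [← intervalIntegral.integral_add_adjacent_intervals (hint ht.le h1.le)
      (hint h1.le le_rfl), below t ht.le le_rfl h1.le,
      above t 1 ht le_rfl h1.le le_rfl fun a _ => by nlinarith [sq_nonneg (a - 1 / 2)]]
    simp only [Real.log_one]
    ring
  · rw [not_le] at h1 h2
    set r := Real.sqrt (1 / 4 - t) with hr
    have hr2 : r ^ 2 = 1 / 4 - t := Real.sq_sqrt (by linarith)
    have hr0 : 0 ≤ r := Real.sqrt_nonneg _
    have hr1 : r < 1 / 2 := by nlinarith
    have hm : 0 < 1 / 2 - r := by linarith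
    have hp : 0 < 1 / 2 + r := by linarith
    have htm : t ≤ 1 / 2 - r := by nlinarith
    have hmid : ∫ a in (1 / 2 - r)..(1 / 2 + r), max (min 1 (t / a) - 1 + a) 0 = 0 := by
      refine (intervalIntegral.integral_congr (g := fun _ => 0) fun a ha => ?_).trans
        intervalIntegral.integral_zero
      rw [uIcc_of_le (by linarith)] at ha
      have ha0 : 0 < a := hm.trans_le ha.1
      apply max_eq_right
      have h5 : a ^ 2 - a + t ≤ 0 := by nlinarith [ha.1, ha.2]
      have h6 : t / a - 1 + a = (a ^ 2 - a + t) / a := by field_simp; ring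
      have := div_nonpos_of_nonpos_of_nonneg h5 ha0.le
      linarith [min_le_right 1 (t / a)]
    have hlog : Real.log (1 / 2 - r) = Real.log t - Real.log (1 / 2 + r) := by
      have : t = (1 / 2 - r) * (1 / 2 + r) := by linear_combination hr2
      rw [this, Real.log_mul hm.ne' hp.ne']; ring
    rw [← intervalIntegral.integral_add_adjacent_intervals (b := t) (hint ht.le h1.le)
      (hint h1.le le_rfl), ← intervalIntegral.integral_add_adjacent_intervals
        (b := 1 / 2 - r) (hint htm (by linarith)) (hint (by linarith) le_rfl),
      ← intervalIntegral.integral_add_adjacent_intervals (b := 1 / 2 + r)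
        (hint (by linarith) (by linarith)) (hint (by linarith) le_rfl),
      below t ht.le le_rfl h1.le, hmid,
      above t _ ht le_rfl htm (by linarith) fun a ha => by nlinarith [ha.1, ha.2],
      above _ 1 hp (by linarith) (by linarith) le_rfl fun a ha => by nlinarith [ha.1, ha.2], hlog]
    simp only [Real.log_one]
    ring

theorem eta_eq_volume {s : ℝ} (hs : 0 < s) :
    eta s = 12 / Real.pi ^ 2 * s * (volume (cutTriangle (1 / s ^ 2))).toReal := by
  have hpi := Real.pi_pos
  have h : 0 < 3 / Real.pi ^ 2 * s ^ 2 := by positivity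
  have h2 : (Real.pi ^ 2 / 3 * (3 / Real.pi ^ 2 * s ^ 2))⁻¹ = 1 / s ^ 2 := by field_simp
  rw [eta, hallH, if_neg (not_le.2 h), h2, hallF_eq_volume (by positivity)]
  ring

theorem eta_nonneg {s : ℝ} (hs : 0 ≤ s) : 0 ≤ eta s := by
  rcases hs.eq_or_lt with rfl | hs
  · simp [eta]
  · rw [eta_eq_volume hs]; positivity

theorem measurable_hallF : Measurable hallF := by
  unfold hallF
  refine Measurable.ite (measurableSet_le measurable_const measurable_id) measurable_const ?_
  refine Measurable.ite (measurableSet_le measurable_const measurable_id) ?_ ?_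
  · fun_prop
  · fun_prop

theorem measurable_eta : Measurable eta := by
  have h : Measurable hallH := by
    unfold hallH
    refine Measurable.ite (measurableSet_le measurable_id measurable_const) measurable_const ?_
    exact measurable_hallF.comp (by fun_prop)
  unfold eta
  exact (by fun_prop : Measurable fun s : ℝ => 6 / Real.pi ^ 2 * s).mul (h.comp (by fun_prop))

theorem eta_le {s : ℝ} (hs : 0 < s) : eta s ≤ 12 / Real.pi ^ 2 * s := by
  rw [eta_eq_volume hs]
  have h : (volume (cutTriangle (1 / s ^ 2))).toReal ≤ 1 :=
    ENNReal.toReal_le_of_le_ofReal zero_le_one (by simpa using volume_cutTriangle_le_one _)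
  exact mul_le_of_le_one_right (by positivity) h

theorem eta_le_rpow {s : ℝ} (hs : 0 < s) : eta s ≤ 96 / Real.pi ^ 2 * s ^ (-3 : ℝ) := by
  rw [eta_eq_volume hs, Real.rpow_neg hs.le]
  have h : s ^ (3 : ℝ) = s ^ 3 := by norm_cast
  rw [h]
  calc _ ≤ 12 / Real.pi ^ 2 * s * (8 * (1 / s ^ 2) ^ 2) := by
        gcongr; exact volume_cutTriangle_le _
    _ = _ := by field_simp; norm_num

/-! ### The limiting distribution on the unit interval -/

/-- The tail `∫_s^∞ η` of the limit density. -/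
noncomputable def etaTail (s : ℝ) : ℝ := ∫ v in Ioi s, eta v

theorem integrableOn_eta : IntegrableOn eta (Ioi 0) := by
  rw [← Ioc_union_Ioi_eq_Ioi (zero_le_one (α := ℝ))]
  refine IntegrableOn.union ?_ ?_
  · refine Measure.integrableOn_of_bounded (M := 12 / Real.pi ^ 2) (by simp)
      measurable_eta.aestronglyMeasurable ?_
    filter_upwards [ae_restrict_mem measurableSet_Ioc] with s hs
    rw [Real.norm_eq_abs, abs_of_nonneg (eta_nonneg hs.1.le)]
    exact (eta_le hs.1).trans (mul_le_of_le_one_right (by positivity) hs.2)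
  · refine Integrable.mono' ((integrableOn_Ioi_rpow_of_lt (a := -3) (by norm_num)
      one_pos).const_mul (96 / Real.pi ^ 2)) measurable_eta.aestronglyMeasurable ?_
    filter_upwards [ae_restrict_mem measurableSet_Ioi] with s hs
    have hs0 : 0 < s := one_pos.trans hs
    rw [Real.norm_eq_abs, abs_of_nonneg (eta_nonneg hs0.le)]
    exact eta_le_rpow hs0

theorem volume_fareyFree_toReal {R δ : ℝ} (hR : 1 ≤ R) (hδ : 0 ≤ δ) :
    (volume (Ioo 0 1 ∩ fareyFree R δ)).toReal =
      ∑ z ∈ coprimePairs R 2, max (1 / ((z.1 : ℝ) * z.2) - δ) 0 := by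
  rw [volume_fareyFree hR hδ, ENNReal.toReal_sum (by simp)]
  exact Finset.sum_congr rfl fun z _ => ENNReal.toReal_ofReal'

/-- The Farey gaps fill the unit interval: this is the case `δ = 0`. -/
theorem sum_one_div_coprimePairs {R : ℝ} (hR : 1 ≤ R) :
    ∑ z ∈ coprimePairs R 2, 1 / ((z.1 : ℝ) * z.2) = 1 := by
  have h := volume_fareyFree_toReal hR le_rfl
  have hu : fareyFree R 0 = univ := by
    ext x; simp [fareyFree]
  rw [hu, inter_univ, Real.volume_Ioo] at h
  simp only [sub_zero, ENNReal.ofReal_one, ENNReal.toReal_one] at h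
  refine Eq.trans ?_ h.symm
  exact Finset.sum_congr rfl fun z _ =>
    (max_eq_left (a := 1 / ((z.1 : ℝ) * z.2)) (by positivity)).symm

theorem integral_two_mul_Ioo {a b R : ℝ} (hab : a ≤ b) :
    ∫ v in Ioo a b, 2 * v / R ^ 2 = (b ^ 2 - a ^ 2) / R ^ 2 := by
  rw [← integral_Ioc_eq_integral_Ioo, ← intervalIntegral.integral_of_le hab,
    intervalIntegral.integral_div, intervalIntegral.integral_const_mul, integral_id]
  ring

/-- Layer-cake form of the measure of the points far from all Farey fractions of order `R`. -/
theorem volume_fareyFree_eq_integral {R s : ℝ} (hR : 1 ≤ R) (hs : 0 < s) :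
    (volume (Ioo 0 1 ∩ fareyFree R (s ^ 2 / R ^ 2))).toReal =
      ∫ v in Ioi s, 2 * v * ((coprimePairs R (1 / v ^ 2)).card / R ^ 2) := by
  have hR0 : 0 < R := by linarith
  rw [volume_fareyFree_toReal hR (by positivity)]
  have hcard : ∀ v : ℝ, 2 * v * ((coprimePairs R (1 / v ^ 2)).card / R ^ 2) =
      ∑ z ∈ coprimePairs R 2,
        if (z.1 : ℝ) * z.2 < 1 / v ^ 2 * R ^ 2 then 2 * v / R ^ 2 else 0 := by
    intro v
    rw [coprimePairs_eq_filter hR0, ← Finset.sum_filter, Finset.sum_const, nsmul_eq_mul]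
    ring
  have hset : ∀ z ∈ coprimePairs R 2, ∀ v ∈ Ioi s,
      (if (z.1 : ℝ) * z.2 < 1 / v ^ 2 * R ^ 2 then 2 * v / R ^ 2 else 0) =
      (Ioo s (R / Real.sqrt (z.1 * z.2))).indicator (fun v => 2 * v / R ^ 2) v := by
    intro z hz v hv
    obtain ⟨h1, h2⟩ := pos_of_mem_latticePairs (Finset.mem_filter.1 hz).1
    have h3 : (0 : ℝ) < z.1 * z.2 := by exact_mod_cast Nat.mul_pos h1 h2
    have hv0 : 0 < v := hs.trans hv
    have hsq := Real.sqrt_pos.2 h3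
    have hiff : (z.1 : ℝ) * z.2 < 1 / v ^ 2 * R ^ 2 ↔ v < R / Real.sqrt (z.1 * z.2) := by
      rw [lt_div_iff₀ hsq, ← pow_lt_pow_iff_left₀ (by positivity) hR0.le two_ne_zero, mul_pow,
        Real.sq_sqrt h3.le, one_div_mul_eq_div, lt_div_iff₀ (by positivity), mul_comm]
    rw [indicator_apply]
    refine if_congr ?_ rfl rfl
    rw [mem_Ioo, and_iff_right (show s < v from hv), hiff]
  have hterm : ∀ z ∈ coprimePairs R 2, max (1 / ((z.1 : ℝ) * z.2) - s ^ 2 / R ^ 2) 0 =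
      ∫ v in Ioi s, (Ioo s (R / Real.sqrt (z.1 * z.2))).indicator (fun v => 2 * v / R ^ 2) v := by
    intro z hz
    obtain ⟨h1, h2⟩ := pos_of_mem_latticePairs (Finset.mem_filter.1 hz).1
    have h3 : (0 : ℝ) < z.1 * z.2 := by exact_mod_cast Nat.mul_pos h1 h2
    have hsq := Real.sqrt_pos.2 h3
    rw [setIntegral_indicator measurableSet_Ioo, inter_eq_right.2 Ioo_subset_Ioi_self]
    have hY : 1 / ((z.1 : ℝ) * z.2) - s ^ 2 / R ^ 2 =
        ((R / Real.sqrt (z.1 * z.2)) ^ 2 - s ^ 2) / R ^ 2 := by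
      rw [div_pow, Real.sq_sqrt h3.le]; field_simp
    rw [hY]
    rcases le_total s (R / Real.sqrt (z.1 * z.2)) with h | h
    · rw [integral_two_mul_Ioo h, max_eq_left]
      apply div_nonneg _ (by positivity)
      nlinarith
    · rw [Ioo_eq_empty (not_lt.2 h), setIntegral_empty, max_eq_right]
      apply div_nonpos_of_nonpos_of_nonneg _ (by positivity)
      have : 0 < R / Real.sqrt (z.1 * z.2) := by positivity
      nlinarith
  simp_rw [hcard]
  rw [setIntegral_congr_fun measurableSet_Ioi fun v hv => Finset.sum_congr rfl fun z hz =>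
    hset z hz v hv, integral_finsetSum, Finset.sum_congr rfl hterm]
  intro z _
  rw [integrable_indicator_iff measurableSet_Ioo]
  refine IntegrableOn.mono_measure ?_ Measure.restrict_le_self
  refine (Continuous.integrableOn_Icc ?_).mono_set Ioo_subset_Icc_self
  fun_prop

theorem integrableOn_rpow_neg_three {s : ℝ} (hs : 0 < s) :
    IntegrableOn (fun v : ℝ => 16 * v ^ (-3 : ℝ)) (Ioi s) :=
  (integrableOn_Ioi_rpow_of_lt (by norm_num) hs).const_mul 16

theorem two_mul_card_coprimePairs_le {R v : ℝ} (hR : 0 < R) (hv : 0 < v) :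
    2 * v * ((coprimePairs R (1 / v ^ 2)).card / R ^ 2) ≤ 16 * v ^ (-3 : ℝ) := by
  have h : v ^ (3 : ℝ) = v ^ 3 := by norm_cast
  rw [Real.rpow_neg hv.le, h]
  calc _ ≤ 2 * v * (8 * (1 / v ^ 2) ^ 2 * R ^ 2 / R ^ 2) := by
        gcongr; exact card_coprimePairs_le hR
    _ = _ := by field_simp; norm_num

theorem aestronglyMeasurable_card_coprimePairs {R s : ℝ} (hR : 0 < R) :
    AEStronglyMeasurable (fun v : ℝ => 2 * v * ((coprimePairs R (1 / v ^ 2)).card / R ^ 2))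
      (volume.restrict (Ioi s)) := by
  have h : ∀ v : ℝ, ((coprimePairs R (1 / v ^ 2)).card : ℝ) = ∑ z ∈ coprimePairs R 2,
      if (z.1 : ℝ) * z.2 < 1 / v ^ 2 * R ^ 2 then (1 : ℝ) else 0 := by
    intro v
    rw [coprimePairs_eq_filter hR, Finset.card_filter]; push_cast; rfl
  simp_rw [h]
  refine Measurable.aestronglyMeasurable ?_
  refine (measurable_const.mul measurable_id).mul (Measurable.div_const ?_ _)
  refine Finset.measurable_sum _ fun z _ => ?_
  exact Measurable.ite (measurableSet_lt measurable_const (by fun_prop)) measurable_const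
    measurable_const

theorem volume_fareyFree_le_inv_sq {R s : ℝ} (hR : 1 ≤ R) (hs : 0 < s) :
    (volume (Ioo 0 1 ∩ fareyFree R (s ^ 2 / R ^ 2))).toReal ≤ 8 / s ^ 2 := by
  have hR0 : 0 < R := by linarith
  rw [volume_fareyFree_eq_integral hR hs]
  calc _ ≤ ∫ v in Ioi s, 16 * v ^ (-3 : ℝ) := by
        refine integral_mono_of_nonneg ?_ (integrableOn_rpow_neg_three hs) ?_
        · filter_upwards [ae_restrict_mem measurableSet_Ioi] with v hv
          have : 0 < v := hs.trans hv
          simp only [Pi.zero_apply]; positivity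
        · filter_upwards [ae_restrict_mem measurableSet_Ioi] with v hv
          exact two_mul_card_coprimePairs_le hR0 (hs.trans hv)
    _ = 8 / s ^ 2 := by
        rw [integral_const_mul, integral_Ioi_rpow_of_lt (by norm_num) hs]
        have h : s ^ (-3 + 1 : ℝ) = (s ^ 2)⁻¹ := by
          rw [show (-3 + 1 : ℝ) = -(2 : ℕ) by norm_num, Real.rpow_neg hs.le, Real.rpow_natCast]
        rw [h]; field_simp; norm_num

theorem one_sub_sq_le_volume_fareyFree {R s : ℝ} (hR : 1 ≤ R) :
    1 - s ^ 2 ≤ (volume (Ioo 0 1 ∩ fareyFree R (s ^ 2 / R ^ 2))).toReal := by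
  have hR0 : 0 < R := by linarith
  rw [volume_fareyFree_toReal hR (by positivity)]
  calc 1 - s ^ 2 ≤ 1 - (coprimePairs R 2).card * (s ^ 2 / R ^ 2) := by
        have h1 : ((coprimePairs R 2).card : ℝ) ≤ R ^ 2 :=
          le_trans (by exact_mod_cast Finset.card_filter_le _ _) (card_latticePairs_le_sq hR0.le 2)
        have h2 : ((coprimePairs R 2).card : ℝ) * (s ^ 2 / R ^ 2) ≤ R ^ 2 * (s ^ 2 / R ^ 2) := by
          gcongr
        have h3 : R ^ 2 * (s ^ 2 / R ^ 2) = s ^ 2 := by field_simp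
        linarith
    _ = ∑ z ∈ coprimePairs R 2, (1 / ((z.1 : ℝ) * z.2) - s ^ 2 / R ^ 2) := by
        rw [Finset.sum_sub_distrib, sum_one_div_coprimePairs hR, Finset.sum_const, nsmul_eq_mul]
    _ ≤ _ := Finset.sum_le_sum fun z _ => le_max_left _ _

theorem tendsto_volume_fareyFree {s : ℝ} (hs : 0 < s) :
    Tendsto (fun R : ℝ => (volume (Ioo 0 1 ∩ fareyFree R (s ^ 2 / R ^ 2))).toReal) atTop
      (𝓝 (etaTail s)) := by
  have h : Tendsto (fun R : ℝ => ∫ v in Ioi s, 2 * v * ((coprimePairs R (1 / v ^ 2)).card / R ^ 2))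
      atTop (𝓝 (∫ v in Ioi s, eta v)) := by
    refine tendsto_integral_filter_of_dominated_convergence (fun v => 16 * v ^ (-3 : ℝ)) ?_ ?_
      (integrableOn_rpow_neg_three hs) ?_
    · filter_upwards [eventually_gt_atTop 0] with R hR
      exact aestronglyMeasurable_card_coprimePairs hR
    · filter_upwards [eventually_gt_atTop 0] with R hR
      filter_upwards [ae_restrict_mem measurableSet_Ioi] with v hv
      have hv0 : 0 < v := hs.trans hv
      rw [Real.norm_eq_abs, abs_of_nonneg (by positivity)]
      exact two_mul_card_coprimePairs_le hR hv0
    · filter_upwards [ae_restrict_mem measurableSet_Ioi] with v hv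
      have hv0 : 0 < v := hs.trans hv
      rw [eta_eq_volume hv0]
      convert (tendsto_card_coprimePairs (1 / v ^ 2)).const_mul (2 * v) using 2
      ring
  refine h.congr' ?_
  filter_upwards [eventually_ge_atTop 1] with R hR
  exact (volume_fareyFree_eq_integral hR hs).symm

/-- The set on which the normalised smallest denominator `√δ * qMin x δ` exceeds `s`. -/
def largeSet (s δ : ℝ) : Set ℝ := {x | s < Real.sqrt δ * qMin x δ}

theorem largeSet_eq {s δ : ℝ} (hδ : 0 < δ) : largeSet s δ = fareyFree (s / Real.sqrt δ) δ := by
  ext x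
  rw [mem_fareyFree_iff_lt_qMin hδ, div_lt_iff₀ (Real.sqrt_pos.2 hδ), mul_comm]
  rfl

theorem measurableSet_largeSet {s δ : ℝ} (hδ : 0 < δ) : MeasurableSet (largeSet s δ) := by
  rw [largeSet_eq hδ]; exact (isClosed_fareyFree _ _).measurableSet

theorem sq_div_div_sqrt_sq {s δ : ℝ} (hs : 0 < s) (hδ : 0 < δ) :
    s ^ 2 / (s / Real.sqrt δ) ^ 2 = δ := by
  rw [div_pow, Real.sq_sqrt hδ.le]; field_simp

/-- The limiting distribution on the full period `(0, 1)`. -/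
theorem tendsto_volume_largeSet {s : ℝ} (hs : 0 < s) :
    Tendsto (fun δ : ℝ => (volume (Ioo 0 1 ∩ largeSet s δ)).toReal) (𝓝[>] 0)
      (𝓝 (etaTail s)) := by
  have h0 : Tendsto (fun δ : ℝ => s / Real.sqrt δ) (𝓝[>] 0) atTop := by
    have h1 : Tendsto Real.sqrt (𝓝[>] 0) (𝓝[>] 0) := by
      refine tendsto_nhdsWithin_iff.2 ⟨?_, ?_⟩
      · have := (Real.continuous_sqrt.tendsto 0).mono_left (nhdsWithin_le_nhds (s := Ioi 0))
        simpa using this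
      · filter_upwards [self_mem_nhdsWithin] with δ hδ using Real.sqrt_pos.2 hδ
    exact (tendsto_inv_nhdsGT_zero.comp h1).const_mul_atTop hs
  refine ((tendsto_volume_fareyFree hs).comp h0).congr' ?_
  filter_upwards [self_mem_nhdsWithin] with δ hδ
  simp only [Function.comp]
  rw [sq_div_div_sqrt_sq hs hδ, largeSet_eq hδ]

theorem volume_largeSet_le_one (s δ : ℝ) : (volume (Ioo 0 1 ∩ largeSet s δ)).toReal ≤ 1 := by
  refine ENNReal.toReal_le_of_le_ofReal zero_le_one ?_
  refine (measure_mono inter_subset_left).trans ?_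
  simp

theorem largeSet_eq_univ {s δ : ℝ} (hδ : 0 < δ) (h : s < Real.sqrt δ) : largeSet s δ = univ := by
  refine eq_univ_of_forall fun x => ?_
  have h1 : (1 : ℝ) ≤ qMin x δ := by exact_mod_cast (isLeast_qMin x hδ).1.1
  exact h.trans_le (le_mul_of_one_le_right (Real.sqrt_nonneg _) h1)

theorem volume_largeSet_le_inv_sq {s δ : ℝ} (hs : 0 < s) (hδ : 0 < δ) (hδ1 : δ ≤ 1) :
    (volume (Ioo 0 1 ∩ largeSet s δ)).toReal ≤ 8 / s ^ 2 := by
  have hsq := Real.sqrt_pos.2 hδ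
  rcases le_or_gt (Real.sqrt δ) s with h | h
  · have := volume_fareyFree_le_inv_sq ((one_le_div hsq).2 h) hs
    rwa [sq_div_div_sqrt_sq hs hδ, ← largeSet_eq hδ] at this
  · refine (volume_largeSet_le_one s δ).trans ?_
    have : s < 1 := h.trans_le (Real.sqrt_le_one.2 hδ1)
    rw [le_div_iff₀ (by positivity)]
    nlinarith

theorem one_sub_sq_le_volume_largeSet {s δ : ℝ} (hs : 0 < s) (hδ : 0 < δ) :
    1 - s ^ 2 ≤ (volume (Ioo 0 1 ∩ largeSet s δ)).toReal := by
  have hsq := Real.sqrt_pos.2 hδ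
  rcases le_or_gt (Real.sqrt δ) s with h | h
  · have := one_sub_sq_le_volume_fareyFree (s := s) ((one_le_div hsq).2 h)
    rwa [sq_div_div_sqrt_sq hs hδ, ← largeSet_eq hδ] at this
  · rw [largeSet_eq_univ hδ h]
    simp; positivity

theorem etaTail_le_one {s : ℝ} (hs : 0 < s) : etaTail s ≤ 1 :=
  le_of_tendsto (tendsto_volume_largeSet hs) <|
    Eventually.of_forall fun δ => volume_largeSet_le_one s δ

theorem etaTail_nonneg {s : ℝ} (hs : 0 < s) : 0 ≤ etaTail s :=
  setIntegral_nonneg measurableSet_Ioi fun _ hv => eta_nonneg (hs.trans hv).le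

theorem etaTail_le_inv_sq {s : ℝ} (hs : 0 < s) : etaTail s ≤ 8 / s ^ 2 := by
  refine le_of_tendsto (tendsto_volume_largeSet hs) ?_
  filter_upwards [Ioc_mem_nhdsGT zero_lt_one] with δ hδ
  exact volume_largeSet_le_inv_sq hs hδ.1 hδ.2

theorem one_sub_sq_le_etaTail {s : ℝ} (hs : 0 < s) : 1 - s ^ 2 ≤ etaTail s := by
  refine ge_of_tendsto (tendsto_volume_largeSet hs) ?_
  filter_upwards [self_mem_nhdsWithin] with δ hδ
  exact one_sub_sq_le_volume_largeSet hs hδ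

theorem etaTail_eq {s : ℝ} (hs : 0 ≤ s) :
    etaTail s = (∫ v in Ioi 0, eta v) - ∫ v in Ioc 0 s, eta v := by
  have h := setIntegral_union (f := eta) (μ := volume)
    (Ioc_disjoint_Ioi (a := (0 : ℝ)) (b := s) le_rfl)
    measurableSet_Ioi (integrableOn_eta.mono_set Ioc_subset_Ioi_self)
    (integrableOn_eta.mono_set (Ioi_subset_Ioi hs))
  rw [Ioc_union_Ioi_eq_Ioi hs] at h
  rw [h, etaTail]; ring

theorem continuousOn_etaTail (b : ℝ) : ContinuousOn etaTail (Icc 0 b) := by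
  have h : IntegrableOn eta (Icc 0 b) := by
    rw [integrableOn_Icc_iff_integrableOn_Ioc]
    exact integrableOn_eta.mono_set Ioc_subset_Ioi_self
  exact (continuousOn_const.sub (intervalIntegral.continuousOn_primitive h)).congr
    fun s hs => etaTail_eq hs.1

theorem continuousAt_etaTail {s : ℝ} (hs : 0 < s) : ContinuousAt etaTail s :=
  (continuousOn_etaTail (s + 1)).continuousAt (Icc_mem_nhds hs (by linarith))

/-- The limit density has total mass `1`, as no mass is lost at `0` by `one_sub_sq_le_etaTail`. -/
theorem integral_eta : ∫ v in Ioi 0, eta v = 1 := by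
  have h1 : Tendsto etaTail (𝓝[>] 0) (𝓝 (etaTail 0)) := by
    have := (continuousOn_etaTail 1) 0 ⟨le_rfl, zero_le_one⟩
    refine this.mono_left ?_
    rw [nhdsWithin_le_iff]
    exact Icc_mem_nhdsGT zero_lt_one
  have h2 : Tendsto etaTail (𝓝[>] 0) (𝓝 1) := by
    refine tendsto_of_tendsto_of_tendsto_of_le_of_le' (g := fun s => 1 - s ^ 2) (h := fun _ => 1)
      ?_ tendsto_const_nhds ?_ ?_
    · have : Tendsto (fun s : ℝ => 1 - s ^ 2) (𝓝 0) (𝓝 (1 - 0 ^ 2)) :=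
        Continuous.tendsto (by fun_prop) 0
      simp only [ne_eq, OfNat.ofNat_ne_zero, not_false_eq_true, zero_pow, sub_zero] at this
      exact this.mono_left nhdsWithin_le_nhds
    · filter_upwards [self_mem_nhdsWithin] with s hs using one_sub_sq_le_etaTail hs
    · filter_upwards [self_mem_nhdsWithin] with s hs using etaTail_le_one hs
  exact tendsto_nhds_unique h1 h2

/-! ### The first moment -/

theorem lintegral_sq_indicator {m : ℝ} (hm : 0 < m) :
    ∫⁻ s in Ioi (0 : ℝ), (if m < 1 / s ^ 2 then ENNReal.ofReal (s ^ 2) else 0) =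
      ENNReal.ofReal (m ^ (-(3 / 2) : ℝ) / 3) := by
  have hY : 0 < 1 / Real.sqrt m := by positivity
  have hset : ∀ s ∈ Ioi (0 : ℝ), (if m < 1 / s ^ 2 then ENNReal.ofReal (s ^ 2) else 0) =
      (Ioo 0 (1 / Real.sqrt m)).indicator (fun s => ENNReal.ofReal (s ^ 2)) s := by
    intro s hs
    have hs0 : 0 < s := hs
    rw [indicator_apply]
    refine if_congr ?_ rfl rfl
    have h : s * Real.sqrt m < 1 ↔ m * s ^ 2 < 1 := by
      rw [← pow_lt_pow_iff_left₀ (a := s * Real.sqrt m) (by positivity) zero_le_one two_ne_zero,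
        mul_pow, Real.sq_sqrt hm.le, one_pow, mul_comm]
    rw [mem_Ioo, and_iff_right hs0, lt_div_iff₀ (by positivity), lt_div_iff₀ (by positivity), h]
  rw [setLIntegral_congr_fun measurableSet_Ioi hset, setLIntegral_indicator measurableSet_Ioo,
    inter_eq_left.2 Ioo_subset_Ioi_self, ← ofReal_integral_eq_lintegral_ofReal]
  · rw [← integral_Ioc_eq_integral_Ioo, ← intervalIntegral.integral_of_le hY.le, integral_pow]
    congr 1
    have h3 : m ^ (-(3 / 2) : ℝ) = (1 / Real.sqrt m) ^ 3 := by
      rw [Real.sqrt_eq_rpow, one_div, ← Real.rpow_neg hm.le, ← Real.rpow_natCast,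
        ← Real.rpow_mul hm.le]
      norm_num
    rw [h3]; norm_num
  · exact (Continuous.integrableOn_Icc (by fun_prop)).mono_set Ioo_subset_Icc_self
  · exact Eventually.of_forall fun s => by positivity

theorem lintegral_rpow_inner {a : ℝ} (h0 : 0 < a) (h1 : a < 1) :
    ∫⁻ b in Ioc (1 - a) 1, ENNReal.ofReal (b ^ (-(3 / 2) : ℝ)) =
      ENNReal.ofReal (2 * (1 / Real.sqrt (1 - a) - 1)) := by
  have h2 : 0 < 1 - a := by linarith
  rw [← ofReal_integral_eq_lintegral_ofReal]
  · rw [← intervalIntegral.integral_of_le (by linarith), integral_rpow]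
    · congr 1
      rw [show (-(3 / 2) + 1 : ℝ) = -(1 / 2) by norm_num, Real.rpow_neg h2.le,
        ← Real.sqrt_eq_rpow, Real.one_rpow]
      field_simp; ring
    · right
      refine ⟨by norm_num, ?_⟩
      rw [uIcc_of_le (by linarith)]
      exact fun h => absurd h.1 (not_le.2 h2)
  · have : ContinuousOn (fun b : ℝ => b ^ (-(3 / 2) : ℝ)) (Icc (1 - a) 1) :=
      continuousOn_id.rpow_const fun b hb => Or.inl (h2.trans_le hb.1).ne'
    exact this.integrableOn_Icc.mono_set Ioc_subset_Icc_self
  · filter_upwards [ae_restrict_mem measurableSet_Ioc] with b hb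
    have : 0 < b := h2.trans hb.1
    simp only [Pi.zero_apply]; positivity

theorem hasDerivAt_sqrt_div {a : ℝ} (h0 : 0 < a) (h1 : a < 1) :
    HasDerivAt (fun a => 4 * Real.sqrt a / (1 + Real.sqrt (1 - a)))
      (a ^ (-(3 / 2) : ℝ) * (2 * (1 / Real.sqrt (1 - a) - 1))) a := by
  have h2 : 0 < 1 - a := by linarith
  have d1 := (Real.hasDerivAt_sqrt h0.ne').const_mul 4
  have d2 : HasDerivAt (fun a => 1 + Real.sqrt (1 - a)) (-1 / (2 * Real.sqrt (1 - a))) a :=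
    (((hasDerivAt_id a).const_sub 1).sqrt h2.ne').const_add 1
  have hx := Real.sqrt_pos.2 h0
  have hy := Real.sqrt_pos.2 h2
  refine (d1.div d2 (by positivity)).congr_deriv ?_
  have e : a ^ (-(3 / 2) : ℝ) = 1 / Real.sqrt a ^ 3 := by
    rw [Real.sqrt_eq_rpow, one_div, ← Real.rpow_natCast, ← Real.rpow_mul h0.le,
      ← Real.rpow_neg h0.le]
    norm_num
  rw [e]
  have hx2 : Real.sqrt a ^ 2 = a := Real.sq_sqrt h0.le
  have hy2 : Real.sqrt (1 - a) ^ 2 = 1 - a := Real.sq_sqrt h2.le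
  set x := Real.sqrt a
  set y := Real.sqrt (1 - a)
  have hrel : x ^ 2 = 1 - y ^ 2 := by linarith
  field_simp
  linear_combination (4 * (y + y ^ 2 + x ^ 2) + 4 * (1 - y ^ 2)) * hrel

/-- `∫∫ (ab)^{-3/2}` over the Farey triangle, with the inner integral evaluated. -/
theorem lintegral_rpow_outer :
    ∫⁻ a in Ioc (0 : ℝ) 1, ENNReal.ofReal (a ^ (-(3 / 2) : ℝ) * (2 * (1 / Real.sqrt (1 - a) - 1)))
      = 4 := by
  -- An antiderivative that extends continuously to the end points of the improper integral.
  have hcont : ContinuousOn (fun a => 4 * Real.sqrt a / (1 + Real.sqrt (1 - a))) (Icc 0 1) := by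
    refine ContinuousOn.div (by fun_prop) (by fun_prop) fun a _ => ?_
    have := Real.sqrt_nonneg (1 - a)
    positivity
  have hpos : ∀ a ∈ Ioo (0 : ℝ) 1, 0 ≤ a ^ (-(3 / 2) : ℝ) * (2 * (1 / Real.sqrt (1 - a) - 1)) := by
    intro a ha
    have h2 : 0 < 1 - a := by linarith [ha.2]
    have h3 : 1 ≤ 1 / Real.sqrt (1 - a) :=
      (one_le_div (Real.sqrt_pos.2 h2)).2 (Real.sqrt_le_one.2 (by linarith [ha.1]))
    have := ha.1
    have h4 : 0 ≤ 1 / Real.sqrt (1 - a) - 1 := by linarith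
    positivity
  have hint := intervalIntegral.integrableOn_deriv_of_nonneg hcont
    (fun a ha => hasDerivAt_sqrt_div ha.1 ha.2) hpos
  have hval := intervalIntegral.integral_eq_sub_of_hasDerivAt_of_le zero_le_one hcont
    (fun a ha => hasDerivAt_sqrt_div ha.1 ha.2)
    ((intervalIntegrable_iff_integrableOn_Ioc_of_le zero_le_one).2 hint)
  rw [← ofReal_integral_eq_lintegral_ofReal hint, ← intervalIntegral.integral_of_le zero_le_one,
    hval]
  · simp
  · rw [← restrict_Ioo_eq_restrict_Ioc]
    filter_upwards [ae_restrict_mem measurableSet_Ioo] with a ha using hpos a ha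

/-- Fubini turns the integral over `s` into `∫∫ (ab)^{-3/2} / 3` over the Farey triangle. -/
theorem lintegral_sq_volume_cutTriangle :
    ∫⁻ s in Ioi (0 : ℝ), ENNReal.ofReal (s ^ 2) * volume (cutTriangle (1 / s ^ 2)) =
      ENNReal.ofReal (4 / 3) := by
  -- For `t = 2` the hyperbola misses the Farey triangle, so `T` is the whole triangle.
  set T : Set (ℝ × ℝ) := cutTriangle 2 with hT
  have hT1 : ∀ z ∈ T, 0 < z.1 ∧ 0 < z.2 := fun z hz =>
    ⟨(cutTriangle_subset 2 hz).1.1, (cutTriangle_subset 2 hz).2.1⟩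
  have hmT : MeasurableSet T := measurableSet_cutTriangle 2
  have hcut : ∀ t, cutTriangle t = T ∩ {z | z.1 * z.2 < t} := by
    intro t
    ext z
    constructor
    · rintro ⟨h1, h2, h3, h4⟩
      exact ⟨⟨h1, h2, h3, by nlinarith⟩, h4⟩
    · rintro ⟨⟨h1, h2, h3, -⟩, h4⟩
      exact ⟨h1, h2, h3, h4⟩
  have hmeas : ∀ t : ℝ, MeasurableSet {z : ℝ × ℝ | z.1 * z.2 < t} := fun t =>
    measurableSet_lt (by fun_prop) measurable_const
  calc ∫⁻ s in Ioi (0 : ℝ), ENNReal.ofReal (s ^ 2) * volume (cutTriangle (1 / s ^ 2))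
      = ∫⁻ s in Ioi (0 : ℝ), ∫⁻ z in T,
          (if z.1 * z.2 < 1 / s ^ 2 then ENNReal.ofReal (s ^ 2) else 0) := by
        refine lintegral_congr fun s => ?_
        have : ∀ z : ℝ × ℝ, (if z.1 * z.2 < 1 / s ^ 2 then ENNReal.ofReal (s ^ 2) else 0) =
            {z : ℝ × ℝ | z.1 * z.2 < 1 / s ^ 2}.indicator (fun _ => ENNReal.ofReal (s ^ 2)) z := by
          intro z; rw [indicator_apply]; rfl
        simp_rw [this]
        rw [lintegral_indicator_const (hmeas _), Measure.restrict_apply (hmeas _), hcut, inter_comm]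
    _ = ∫⁻ z in T, ∫⁻ s in Ioi (0 : ℝ),
          (if z.1 * z.2 < 1 / s ^ 2 then ENNReal.ofReal (s ^ 2) else 0) := by
        refine lintegral_lintegral_swap (Measurable.aemeasurable ?_)
        simp only [Function.uncurry_def]
        refine Measurable.ite (measurableSet_lt ?_ ?_) ?_ measurable_const <;> fun_prop
    _ = ∫⁻ z in T, ENNReal.ofReal ((z.1 * z.2) ^ (-(3 / 2) : ℝ) / 3) := by
        refine setLIntegral_congr_fun hmT fun z hz => ?_
        exact lintegral_sq_indicator (mul_pos (hT1 z hz).1 (hT1 z hz).2)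
    _ = ∫⁻ a, ∫⁻ b, T.indicator
          (fun z => ENNReal.ofReal ((z.1 * z.2) ^ (-(3 / 2) : ℝ) / 3)) (a, b) := by
        rw [← lintegral_indicator hmT, Measure.volume_eq_prod, lintegral_prod]
        exact (Measurable.indicator (by fun_prop) hmT).aemeasurable
    _ = ∫⁻ a in Ioc (0 : ℝ) 1, ENNReal.ofReal (1 / 3) *
          ENNReal.ofReal (a ^ (-(3 / 2) : ℝ) * (2 * (1 / Real.sqrt (1 - a) - 1))) := by
        rw [← restrict_Ioo_eq_restrict_Ioc, ← lintegral_indicator measurableSet_Ioo]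
        refine lintegral_congr_ae ?_
        have hne : ∀ᵐ a : ℝ, a ≠ 1 := by
          rw [ae_iff]; simp
        filter_upwards [hne] with a ha1
        by_cases ha : a ∈ Ioo (0 : ℝ) 1
        · rw [indicator_of_mem ha]
          have hslice : ∀ b, T.indicator
              (fun z => ENNReal.ofReal ((z.1 * z.2) ^ (-(3 / 2) : ℝ) / 3)) (a, b) =
              (Ioc (1 - a) 1).indicator (fun b => ENNReal.ofReal (a ^ (-(3 / 2) : ℝ) / 3) *
                ENNReal.ofReal (b ^ (-(3 / 2) : ℝ))) b := by
            intro b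
            have hiff : (a, b) ∈ T ↔ b ∈ Ioc (1 - a) 1 := by
              simp only [hT, cutTriangle, mem_ofPred_eq, mem_Ioc]
              constructor
              · rintro ⟨-, h2, h3, -⟩; exact ⟨by linarith, h2⟩
              · rintro ⟨h3, h2⟩; exact ⟨ha.2.le, h2, by linarith, by nlinarith [ha.1, ha.2]⟩
            by_cases hb : (a, b) ∈ T
            · have hb0 : 0 < b := (hT1 _ hb).2
              rw [indicator_of_mem hb, indicator_of_mem (hiff.1 hb), ← ENNReal.ofReal_mul
                (by have := ha.1; positivity), Real.mul_rpow ha.1.le hb0.le]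
              congr 1; ring
            · rw [indicator_of_notMem hb, indicator_of_notMem fun h => hb (hiff.2 h)]
          simp_rw [hslice]
          rw [lintegral_indicator measurableSet_Ioc, lintegral_const_mul _ (by fun_prop),
            lintegral_rpow_inner ha.1 ha.2, ← ENNReal.ofReal_mul (by have := ha.1; positivity),
            ← ENNReal.ofReal_mul (by norm_num)]
          congr 1; ring
        · rw [indicator_of_notMem ha]
          have : ∀ b, (a, b) ∉ T := fun b hb => ha
            ⟨(hT1 _ hb).1, lt_of_le_of_ne hb.1 ha1⟩
          simp [indicator_of_notMem (this _)]
    _ = ENNReal.ofReal (4 / 3) := by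
        rw [lintegral_const_mul _ (by fun_prop), lintegral_rpow_outer,
          show (4 : ENNReal) = ENNReal.ofReal 4 by simp, ← ENNReal.ofReal_mul (by norm_num)]
        congr 1; norm_num

theorem momentM_one : momentM 1 = 16 / (Real.pi : ℂ) ^ 2 := by
  have h1 : ∫ s in Ioi (0 : ℝ), s * eta s = 16 / Real.pi ^ 2 := by
    rw [integral_eq_lintegral_of_nonneg_ae]
    · have : ∀ s ∈ Ioi (0 : ℝ), ENNReal.ofReal (s * eta s) = ENNReal.ofReal (12 / Real.pi ^ 2) *
          (ENNReal.ofReal (s ^ 2) * volume (cutTriangle (1 / s ^ 2))) := by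
        intro s hs
        have hs0 : 0 < s := hs
        rw [eta_eq_volume hs0, ← ENNReal.ofReal_toReal (volume_cutTriangle_ne_top (1 / s ^ 2)),
          ← ENNReal.ofReal_mul (by positivity), ← ENNReal.ofReal_mul (by positivity),
          ENNReal.toReal_ofReal (by positivity)]
        congr 1; ring
      rw [setLIntegral_congr_fun measurableSet_Ioi this, lintegral_const_mul' _ _ (by simp),
        lintegral_sq_volume_cutTriangle, ← ENNReal.ofReal_mul (by positivity),
        ENNReal.toReal_ofReal (by positivity)]
      ring
    · filter_upwards [ae_restrict_mem measurableSet_Ioi] with s hs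
      exact mul_nonneg (le_of_lt hs) (eta_nonneg (le_of_lt hs))
    · exact (measurable_id.mul measurable_eta).aestronglyMeasurable
  rw [momentM]
  simp_rw [Complex.cpow_one, ← Complex.ofReal_mul]
  rw [integral_complex_ofReal, h1]
  push_cast; rfl

/-! ### Smallest denominators under unimodular maps -/

theorem moebius_sub {a b c d e : ℝ} (he : a * d - b * c = e) {u v : ℝ} (hu : 0 < c * u + d)
    (hv : 0 < c * v + d) : (a * v + b) / (c * v + d) - (a * u + b) / (c * u + d) =
      e * (v - u) / ((c * v + d) * (c * u + d)) := by
  rw [div_sub_div _ _ hv.ne' hu.ne', ← he]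
  congr 1; ring

theorem qMin_le {x δ : ℝ} {n : ℕ} (hn : 0 < n) {p : ℤ} (h : |(p : ℝ) / n - x| < δ / 2) :
    qMin x δ ≤ n := by
  rw [abs_lt] at h
  exact Nat.sInf_le ⟨hn, p, by linarith, by linarith⟩

theorem exists_abs_sub_lt_qMin (x : ℝ) {δ : ℝ} (hδ : 0 < δ) :
    0 < qMin x δ ∧ ∃ p : ℤ, |(p : ℝ) / qMin x δ - x| < δ / 2 := by
  obtain ⟨⟨h0, p, h1, h2⟩, -⟩ := isLeast_qMin x hδ
  exact ⟨h0, p, abs_lt.2 ⟨by linarith, by linarith⟩⟩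

/-- A fraction `v` close to `u` is mapped by a unimodular fractional linear map `g` to a fraction
close to `g u`; the denominator is multiplied by `c v + d`, distances by about `(c v + d)⁻²`. -/
theorem qMin_moebius_le {a b c d e : ℤ} (he : a * d - b * c = e) (he1 : |e| = 1) {u lam Lam δ : ℝ}
    (hlam : 0 < lam) (hδ : 0 < δ) (hδL : δ * Lam ^ 2 ≤ 2)
    (hb : ∀ v : ℝ, |v - u| ≤ 1 → lam ≤ c * v + d ∧ c * v + d ≤ Lam) :
    (qMin ((a * u + b) / (c * u + d)) δ : ℝ) ≤ Lam * qMin u (δ * lam ^ 2) := by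
  obtain ⟨h0, p, hp⟩ := exists_abs_sub_lt_qMin u (δ := δ * lam ^ 2) (by positivity)
  set q := qMin u (δ * lam ^ 2)
  have hq : (0 : ℝ) < q := by exact_mod_cast h0
  set v : ℝ := p / q
  have hu := hb u (by simp)
  have hlL : lam ≤ Lam := hu.1.trans hu.2
  have hvu : |v - u| ≤ 1 := by
    have : δ * lam ^ 2 ≤ δ * Lam ^ 2 := by gcongr
    linarith
  have hv := hb v hvu
  have hu0 : 0 < (c : ℝ) * u + d := hlam.trans_le hu.1
  have hv0 : 0 < (c : ℝ) * v + d := hlam.trans_le hv.1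
  have hn : ((c * p + d * q : ℤ) : ℝ) = q * (c * v + d) := by
    push_cast; simp only [v]; field_simp
  have hn0 : 0 < c * p + d * q := by
    have : (0 : ℝ) < ((c * p + d * q : ℤ) : ℝ) := by rw [hn]; positivity
    exact_mod_cast this
  obtain ⟨n, hnn⟩ := Int.eq_ofNat_of_zero_le hn0.le
  have hnn' : (n : ℝ) = q * (c * v + d) := by rw [← hn, hnn]; simp
  have hle : qMin ((a * u + b) / (c * u + d)) δ ≤ n := by
    refine qMin_le (p := a * p + b * q) (by omega) ?_
    have hm : ((a * p + b * q : ℤ) : ℝ) / n = (a * v + b) / (c * v + d) := by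
      rw [hnn']; push_cast; simp only [v]
      field_simp
    rw [hm, moebius_sub (e := (e : ℝ)) (by exact_mod_cast he) hu0 hv0, abs_div, abs_mul,
      show |(e : ℝ)| = 1 by exact_mod_cast he1, one_mul, abs_of_pos (mul_pos hv0 hu0),
      div_lt_iff₀ (mul_pos hv0 hu0)]
    calc |v - u| < δ / 2 * (lam * lam) := by linarith
      _ ≤ δ / 2 * ((c * v + d) * (c * u + d)) := by
        gcongr
        · exact hv.1
        · exact hu.1
  calc ((qMin ((a * u + b) / (c * u + d)) δ : ℕ) : ℝ) ≤ n := by exact_mod_cast hle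
    _ = (c * v + d) * q := by rw [hnn']; ring
    _ ≤ Lam * q := by gcongr; exact hv.2

/-- The converse of `qMin_moebius_le`: a fraction close to `g u` comes from a fraction close to
`u`. -/
theorem le_qMin_moebius {a b c d e : ℤ} (he : a * d - b * c = e) (he1 : |e| = 1) (hc : 0 ≤ c)
    {u lam Lam δ : ℝ} (hlam : 0 < lam) (hδ : 0 < δ) (hδL : δ * Lam ^ 2 ≤ 2)
    (hb : ∀ v : ℝ, |v - u| ≤ 1 → lam ≤ c * v + d ∧ c * v + d ≤ Lam) :
    lam * qMin u (δ * Lam ^ 2) ≤ qMin ((a * u + b) / (c * u + d)) δ := by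
  obtain ⟨h0, p, hp⟩ := exists_abs_sub_lt_qMin ((a * u + b) / (c * u + d)) hδ
  set q := qMin ((a * u + b) / (c * u + d)) δ
  set x : ℝ := (a * u + b) / (c * u + d) with hx
  have hq : (0 : ℝ) < q := by exact_mod_cast h0
  have hu := hb u (by simp)
  have hu1 := hb (u + 1) (by simp)
  have hu2 := hb (u - 1) (by simp)
  set L : ℝ := c * u + d with hL
  have hL0 : 0 < L := hlam.trans_le hu.1
  have hc' : (0 : ℝ) ≤ c := by exact_mod_cast hc
  have hplus : L + c ≤ Lam := by linarith [hu1.2]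
  have hminus : lam ≤ L - c := by linarith [hu2.1]
  have he' : (a : ℝ) * d - b * c = e := by exact_mod_cast he
  have hee : (e : ℝ) * e = 1 := by
    rcases (abs_eq (zero_le_one (α := ℤ))).1 he1 with h | h <;> rw [h] <;> norm_num
  have hea : |(e : ℝ)| = 1 := by exact_mod_cast he1
  set y : ℝ := p / q with hy
  set w : ℝ := e * (a - c * y) with hw
  have hxL : x * L = a * u + b := by rw [hx]; field_simp
  have hwx : (e : ℝ) * (a - c * x) = 1 / L := by
    rw [eq_div_iff hL0.ne']
    linear_combination (-(e : ℝ) * c) * hxL + e * a * hL + e * he' + hee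
  have hdiff : |w - 1 / L| ≤ c * (δ / 2) := by
    rw [← hwx, hw, show (e : ℝ) * (a - c * y) - e * (a - c * x) = -(e * (c * (y - x))) by ring,
      abs_neg, abs_mul, hea, one_mul, abs_mul, abs_of_nonneg hc']
    gcongr
  have hLam0 : 0 < Lam := by linarith
  have hδ2 : δ / 2 ≤ 1 / Lam ^ 2 := by
    rw [le_div_iff₀ (by positivity)]; linarith
  have hcd : (c : ℝ) * (δ / 2) ≤ c / Lam ^ 2 := by
    calc (c : ℝ) * (δ / 2) ≤ c * (1 / Lam ^ 2) := by gcongr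
      _ = _ := by ring
  have hLc : 0 < L - c := hlam.trans_le hminus
  -- With `v` the preimage of `y`, `w = 1 / (c v + d)`; its distance from `1 / L` is small enough
  -- for `1 / w` to stay between `lam` and `Lam`.
  have hw1 : 1 / Lam ≤ w := by
    have h1 : 1 / L - 1 / (L + c) = c / (L * (L + c)) := by
      have : 0 < L + c := by linarith
      field_simp; ring
    have h2 : (c : ℝ) / Lam ^ 2 ≤ c / (L * (L + c)) := by
      rw [sq]
      have : 0 < L + c := by linarith
      gcongr
      exact hu.2
    have h3 : 1 / Lam ≤ 1 / (L + c) := one_div_le_one_div_of_le (by linarith) hplus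
    have := (abs_le.1 hdiff).1
    linarith
  have hw2 : w ≤ 1 / lam := by
    have h1 : 1 / (L - c) - 1 / L = c / (L * (L - c)) := by
      field_simp; ring
    have h2 : (c : ℝ) / Lam ^ 2 ≤ c / (L * (L - c)) := by
      rw [sq]
      gcongr
      · exact hu.2
      · linarith
    have h3 : 1 / (L - c) ≤ 1 / lam := one_div_le_one_div_of_le hlam hminus
    have := (abs_le.1 hdiff).2
    linarith
  have hw0 : 0 < w := lt_of_lt_of_le (by positivity) hw1
  have hn : ((e * (a * q - c * p) : ℤ) : ℝ) = q * w := by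
    push_cast; rw [hw, hy]; field_simp
  have hn0 : 0 < e * (a * q - c * p) := by
    have : (0 : ℝ) < ((e * (a * q - c * p) : ℤ) : ℝ) := by rw [hn]; positivity
    exact_mod_cast this
  obtain ⟨n, hnn⟩ := Int.eq_ofNat_of_zero_le hn0.le
  have hnn' : (n : ℝ) = q * w := by rw [← hn, hnn]; simp
  have hle : qMin u (δ * Lam ^ 2) ≤ n := by
    refine qMin_le (p := e * (d * p - b * q)) (by omega) ?_
    have hm : ((e * (d * p - b * q) : ℤ) : ℝ) / n = e * (d * y - b) / w := by
      rw [hnn', div_eq_div_iff (by positivity) hw0.ne']; push_cast; rw [hy]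
      field_simp
    have hvu : (e : ℝ) * (d * y - b) / w - u = e * L * (y - x) / w := by
      rw [div_sub' hw0.ne', div_left_inj' hw0.ne', hw]
      linear_combination (e : ℝ) * hxL + (-(e : ℝ) * y) * hL
    rw [hm, hvu, abs_div, abs_mul, abs_mul, hea, one_mul, abs_of_pos hL0, abs_of_pos hw0,
      div_lt_iff₀ hw0]
    calc L * |y - x| < L * (δ / 2) := by gcongr
      _ ≤ Lam * (δ / 2) := by gcongr; exact hu.2
      _ = δ * Lam ^ 2 / 2 * (1 / Lam) := by field_simp
      _ ≤ _ := by gcongr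
  have : (qMin u (δ * Lam ^ 2) : ℝ) ≤ n := by exact_mod_cast hle
  calc lam * qMin u (δ * Lam ^ 2) ≤ lam * (q * w) := by rw [← hnn']; gcongr
    _ ≤ lam * (q * (1 / lam)) := by gcongr
    _ = q := by field_simp

theorem qMin_add_intCast (x δ : ℝ) (n : ℤ) : qMin (x + n) δ = qMin x δ := by
  have h : ∀ (x : ℝ) (n : ℤ), denominators x δ ⊆ denominators (x + n) δ := by
    rintro x n q ⟨hq, p, h1, h2⟩
    have hq0 : (q : ℝ) ≠ 0 := by exact_mod_cast hq.ne'
    have e : ((p + n * q : ℤ) : ℝ) / q = p / q + n := by push_cast; field_simp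
    exact ⟨hq, p + n * q, by rw [e]; linarith, by rw [e]; linarith⟩
  rw [qMin, qMin]
  congr 1
  refine Subset.antisymm ?_ (h x n)
  have := h (x + n) (-n)
  simpa using this

theorem volume_Icc_inter_largeSet (s δ : ℝ) (n : ℤ) :
    volume (Icc (n : ℝ) (n + 1) ∩ largeSet s δ) = volume (Ioo 0 1 ∩ largeSet s δ) := by
  have h1 : volume (Ioo 0 1 ∩ largeSet s δ) = volume (Icc 0 1 ∩ largeSet s δ) :=
    measure_congr (Ioo_ae_eq_Icc.inter (ae_eq_refl _))
  rw [h1, ← measure_preimage_add_right volume (n : ℝ) (Icc (n : ℝ) (n + 1) ∩ largeSet s δ)]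
  congr 1
  ext x
  simp only [mem_preimage, mem_inter_iff, mem_Icc, largeSet, mem_ofPred_eq, qMin_add_intCast]
  constructor
  · rintro ⟨⟨h2, h3⟩, h4⟩; exact ⟨⟨by linarith, by linarith⟩, h4⟩
  · rintro ⟨⟨h2, h3⟩, h4⟩; exact ⟨⟨by linarith, by linarith⟩, h4⟩

theorem volume_le_of_subset_image {f : ℝ → ℝ} {K : ℝ} (hK : 0 ≤ K) {A S : Set ℝ}
    (hf : ∀ u ∈ A, ∀ v ∈ A, |f u - f v| ≤ K * |u - v|) (hS : S ⊆ f '' A)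
    (hA : volume A ≠ ⊤) : (volume S).toReal ≤ K * (volume A).toReal := by
  have hL : LipschitzOnWith K.toNNReal f A := by
    refine LipschitzOnWith.of_dist_le_mul fun u hu v hv => ?_
    rw [Real.dist_eq, Real.dist_eq, Real.coe_toNNReal K hK]
    exact hf u hu v hv
  have h := hL.hausdorffMeasure_image_le (d := 1) zero_le_one
  rw [hausdorffMeasure_real, ENNReal.rpow_one] at h
  have h2 := (measure_mono hS).trans h
  refine (ENNReal.toReal_mono (ENNReal.mul_ne_top ENNReal.coe_ne_top hA) h2).trans ?_
  rw [ENNReal.toReal_mul]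
  simp [hK]

/-! ### Discrepancy far from the pole of a unimodular map -/

/-- The signed deviation, over the interval from `a` to `b`, of the measure of `largeSet s δ` from
the length times `etaTail s`. -/
noncomputable def discrepancy (s δ a b : ℝ) : ℝ :=
  ∫ x in a..b, ((largeSet s δ).indicator (fun _ => (1 : ℝ)) x - etaTail s)

theorem intervalIntegrable_discrepancy (s : ℝ) {δ : ℝ} (hδ : 0 < δ) (a b : ℝ) :
    IntervalIntegrable (fun x => (largeSet s δ).indicator (fun _ => (1 : ℝ)) x - etaTail s)
      volume a b := by
  refine IntervalIntegrable.sub ?_ intervalIntegrable_const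
  have h : IntervalIntegrable (fun _ : ℝ => (1 : ℝ)) volume a b := intervalIntegrable_const
  exact ⟨h.1.indicator (measurableSet_largeSet hδ), h.2.indicator (measurableSet_largeSet hδ)⟩

theorem discrepancy_add (s : ℝ) {δ : ℝ} (hδ : 0 < δ) (a b c : ℝ) :
    discrepancy s δ a b + discrepancy s δ b c = discrepancy s δ a c :=
  intervalIntegral.integral_add_adjacent_intervals (intervalIntegrable_discrepancy s hδ a b)
    (intervalIntegrable_discrepancy s hδ b c)

theorem discrepancy_symm (s δ a b : ℝ) : discrepancy s δ b a = -discrepancy s δ a b :=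
  intervalIntegral.integral_symm _ _

theorem discrepancy_of_le (s : ℝ) {δ : ℝ} (hδ : 0 < δ) {a b : ℝ} (hab : a ≤ b) :
    discrepancy s δ a b = (volume (Icc a b ∩ largeSet s δ)).toReal - (b - a) * etaTail s := by
  rw [discrepancy, intervalIntegral.integral_sub, intervalIntegral.integral_const, smul_eq_mul,
    intervalIntegral.integral_of_le hab, setIntegral_indicator (measurableSet_largeSet hδ),
    setIntegral_const, smul_eq_mul, mul_one]
  · have h : volume (Ioc a b ∩ largeSet s δ) = volume (Icc a b ∩ largeSet s δ) :=
      measure_congr (Ioc_ae_eq_Icc.inter (ae_eq_refl _))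
    rw [Measure.real, h]
  · have h : IntervalIntegrable (fun _ : ℝ => (1 : ℝ)) volume a b := intervalIntegrable_const
    exact ⟨h.1.indicator (measurableSet_largeSet hδ), h.2.indicator (measurableSet_largeSet hδ)⟩
  · exact intervalIntegrable_const

theorem abs_discrepancy (s : ℝ) {δ : ℝ} (hδ : 0 < δ) (a b : ℝ) :
    |discrepancy s δ a b| =
      |(volume (uIcc a b ∩ largeSet s δ)).toReal - |b - a| * etaTail s| := by
  rcases le_total a b with h | h
  · rw [discrepancy_of_le s hδ h, uIcc_of_le h, abs_of_nonneg (sub_nonneg.2 h)]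
  · rw [discrepancy_symm, abs_neg, discrepancy_of_le s hδ h, uIcc_of_ge h, abs_sub_comm b a,
      abs_of_nonneg (sub_nonneg.2 h)]

theorem abs_discrepancy_le {s : ℝ} (hs : 0 < s) (δ a b : ℝ) :
    |discrepancy s δ a b| ≤ |b - a| := by
  have := intervalIntegral.norm_integral_le_of_norm_le_const (a := a) (b := b) (C := 1)
    (f := fun x => (largeSet s δ).indicator (fun _ => (1 : ℝ)) x - etaTail s) fun x _ => by
      have h1 := etaTail_le_one hs
      have h2 := etaTail_nonneg hs
      rw [Real.norm_eq_abs, abs_le]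
      by_cases hx : x ∈ largeSet s δ
      · rw [indicator_of_mem hx]; constructor <;> linarith
      · rw [indicator_of_notMem hx]; constructor <;> linarith
  rwa [one_mul] at this

theorem tendsto_mul_const_nhdsGT {k : ℝ} (hk : 0 < k) :
    Tendsto (fun δ : ℝ => δ * k) (𝓝[>] 0) (𝓝[>] 0) := by
  refine tendsto_nhdsWithin_iff.2 ⟨?_, ?_⟩
  · have : Tendsto (fun δ : ℝ => δ * k) (𝓝 0) (𝓝 (0 * k)) := Continuous.tendsto (by fun_prop) 0
    rw [zero_mul] at this
    exact this.mono_left nhdsWithin_le_nhds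
  · filter_upwards [self_mem_nhdsWithin] with δ hδ using mul_pos hδ hk

theorem volume_Icc_inter_compl_largeSet (s : ℝ) {δ : ℝ} (hδ : 0 < δ) (n : ℤ) :
    (volume (Icc (n : ℝ) (n + 1) ∩ (largeSet s δ)ᶜ)).toReal =
      1 - (volume (Ioo 0 1 ∩ largeSet s δ)).toReal := by
  have h := measureReal_inter_add_sdiff (μ := volume) (s := Icc (n : ℝ) (n + 1))
    (measurableSet_largeSet (s := s) hδ) (by simp)
  rw [sdiff_eq] at h
  simp only [Measure.real, volume_Icc_inter_largeSet, Real.volume_Icc, add_sub_cancel_left,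
    ENNReal.ofReal_one, ENNReal.toReal_one] at h
  linarith

/-- On the image of `[j, j + 1]` under a unimodular fractional linear map without pole nearby, the
measure of `largeSet s δ` is controlled by that for `[0, 1]` at slightly different parameters. -/
theorem eventually_abs_discrepancy_image_le {a b c d e : ℤ} (he : a * d - b * c = e)
    (he1 : |e| = 1) (hc : 0 ≤ c) {j : ℤ} {s κ lam Lam : ℝ} (hs : 0 < s)
    (hlam : 0 < lam) (hl : lam = c * (j - 1) + d) (hL : Lam = c * (j + 2) + d)
    (hG1 : (Lam / lam) ^ 2 * etaTail (s / (Lam / lam)) < etaTail s + κ)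
    (hG2 : (Lam / lam) ^ 2 * (1 - etaTail (s * (Lam / lam))) < 1 - etaTail s + κ) :
    ∀ᶠ δ in 𝓝[>] (0 : ℝ), |discrepancy s δ ((a * j + b) / (c * j + d))
      ((a * (j + 1) + b) / (c * (j + 1) + d))| ≤
        κ * |((a * (j + 1) + b) / (c * (j + 1) + d) - (a * j + b) / (c * j + d) : ℝ)| := by
  have hc' : (0 : ℝ) ≤ c := by exact_mod_cast hc
  have hlL : lam ≤ Lam := by rw [hl, hL]; nlinarith
  have hL0 : 0 < Lam := hlam.trans_le hlL
  set ρ := Lam / lam with hρ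
  have hρ1 : 1 ≤ ρ := (one_le_div hlam).2 hlL
  have hρ0 : 0 < ρ := by linarith
  set f : ℝ → ℝ := fun u => (a * u + b) / (c * u + d) with hf
  set A : Set ℝ := Icc (j : ℝ) (j + 1) with hA
  have hbd : ∀ u ∈ A, ∀ v : ℝ, |v - u| ≤ 1 → lam ≤ c * v + d ∧ c * v + d ≤ Lam := by
    intro u hu v hv
    rw [abs_le] at hv
    have h1 : (j : ℝ) - 1 ≤ v := by linarith [hu.1]
    have h2 : v ≤ (j : ℝ) + 2 := by linarith [hu.2]
    rw [hl, hL]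
    constructor <;> gcongr
  have hbu : ∀ u ∈ A, lam ≤ c * u + d ∧ c * u + d ≤ Lam := fun u hu => hbd u hu u (by simp)
  have hjA : (j : ℝ) ∈ A := ⟨le_rfl, by linarith⟩
  have hjA' : (j : ℝ) + 1 ∈ A := ⟨by linarith, le_rfl⟩
  have hea : |(e : ℝ)| = 1 := by exact_mod_cast he1
  have hsub : ∀ u ∈ A, ∀ v ∈ A, f u - f v = e * (u - v) / ((c * u + d) * (c * v + d)) :=
    fun u hu v hv => moebius_sub (by exact_mod_cast he) (hlam.trans_le (hbu v hv).1)
      (hlam.trans_le (hbu u hu).1)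
  have hLip : ∀ u ∈ A, ∀ v ∈ A, |f u - f v| ≤ (lam ^ 2)⁻¹ * |u - v| := by
    intro u hu v hv
    have h1 := hlam.trans_le (hbu u hu).1
    have h2 := hlam.trans_le (hbu v hv).1
    rw [hsub u hu v hv, abs_div, abs_mul, hea, one_mul, abs_of_pos (mul_pos h1 h2),
      div_eq_inv_mul, sq]
    gcongr
    · exact (hbu u hu).1
    · exact (hbu v hv).1
  set ℓ : ℝ := |f (j + 1) - f j| with hℓ
  have hℓ1 : (lam ^ 2)⁻¹ ≤ ρ ^ 2 * ℓ := by
    have h1 := hlam.trans_le (hbu _ hjA).1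
    have h2 := hlam.trans_le (hbu _ hjA').1
    have : (Lam ^ 2)⁻¹ ≤ ℓ := by
      rw [hℓ, hsub _ hjA' _ hjA, abs_div, abs_mul, hea, one_mul, abs_of_pos (mul_pos h2 h1),
        add_sub_cancel_left, abs_one, ← one_div, sq]
      gcongr
      · exact (hbu _ hjA').2
      · exact (hbu _ hjA).2
    calc (lam ^ 2)⁻¹ = ρ ^ 2 * (Lam ^ 2)⁻¹ := by rw [hρ]; field_simp
      _ ≤ _ := by gcongr
  have hℓ0 : 0 < ℓ := by
    have : 0 < ρ ^ 2 * ℓ := lt_of_lt_of_le (by positivity) hℓ1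
    exact (pos_iff_pos_of_mul_pos this).1 (by positivity)
  have hcont : ContinuousOn f A := ContinuousOn.div (by fun_prop) (by fun_prop) fun u hu =>
    (hlam.trans_le (hbu u hu).1).ne'
  have himg : uIcc (f j) (f (j + 1)) ⊆ f '' A := by
    have := intermediate_value_uIcc (a := (j : ℝ)) (b := j + 1) (f := f)
    rw [uIcc_of_le (by linarith)] at this
    exact this hcont
  have hAfin : ∀ S : Set ℝ, volume (A ∩ S) ≠ ⊤ := fun S =>
    ((measure_mono inter_subset_left).trans_lt (by simp [hA])).ne
  -- Both the set and its complement are bounded from above through Lipschitz images of the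
  -- corresponding sets in `[j, j + 1]`, which gives the two sides of the estimate.
  have hV : ∀ᶠ δ in 𝓝[>] (0 : ℝ),
      (volume (uIcc (f j) (f (j + 1)) ∩ largeSet s δ)).toReal ≤ ℓ * (etaTail s + κ) := by
    have hlim := ((tendsto_volume_largeSet (s := s / ρ) (by positivity)).comp
      (tendsto_mul_const_nhdsGT (k := lam ^ 2) (by positivity))).const_mul ((lam ^ 2)⁻¹)
    have hlt : (lam ^ 2)⁻¹ * etaTail (s / ρ) < ℓ * (etaTail s + κ) := by
      calc (lam ^ 2)⁻¹ * etaTail (s / ρ) ≤ ρ ^ 2 * ℓ * etaTail (s / ρ) := by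
            gcongr; exact etaTail_nonneg (by positivity)
        _ = ℓ * (ρ ^ 2 * etaTail (s / ρ)) := by ring
        _ < _ := by gcongr
    filter_upwards [hlim.eventually_lt_const hlt, self_mem_nhdsWithin,
      Ioc_mem_nhdsGT (show 0 < 2 / Lam ^ 2 by positivity)] with δ h1 hδ hδ2
    have hδ0 : 0 < δ := hδ
    have hδL : δ * Lam ^ 2 ≤ 2 := (le_div_iff₀ (by positivity)).1 hδ2.2
    refine le_trans ?_ h1.le
    simp only [Function.comp]
    rw [← volume_Icc_inter_largeSet _ _ j]
    refine volume_le_of_subset_image (f := f) (by positivity)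
      (fun u hu v hv => hLip u hu.1 v hv.1) ?_ (hAfin _)
    rintro x ⟨hx1, hx2⟩
    obtain ⟨u, hu, rfl⟩ := himg hx1
    refine ⟨u, ⟨hu, ?_⟩, rfl⟩
    have hq := qMin_moebius_le he he1 hlam hδ0 hδL (hbd u hu)
    have hx2' : s < Real.sqrt δ * qMin (f u) δ := hx2
    change s / ρ < Real.sqrt (δ * lam ^ 2) * _
    rw [div_lt_iff₀ hρ0, Real.sqrt_mul hδ0.le, Real.sqrt_sq hlam.le]
    calc s < Real.sqrt δ * qMin (f u) δ := hx2'
      _ ≤ Real.sqrt δ * (Lam * qMin u (δ * lam ^ 2)) := by gcongr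
      _ = _ := by rw [hρ]; field_simp
  have hW : ∀ᶠ δ in 𝓝[>] (0 : ℝ),
      (volume (uIcc (f j) (f (j + 1)) ∩ (largeSet s δ)ᶜ)).toReal ≤ ℓ * (1 - etaTail s + κ) := by
    have hlim := (((tendsto_volume_largeSet (s := s * ρ) (by positivity)).comp
      (tendsto_mul_const_nhdsGT (k := Lam ^ 2) (by positivity))).const_sub 1).const_mul
        ((lam ^ 2)⁻¹)
    have hlt : (lam ^ 2)⁻¹ * (1 - etaTail (s * ρ)) < ℓ * (1 - etaTail s + κ) := by
      calc (lam ^ 2)⁻¹ * (1 - etaTail (s * ρ)) ≤ ρ ^ 2 * ℓ * (1 - etaTail (s * ρ)) := by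
            gcongr; exact sub_nonneg.2 (etaTail_le_one (by positivity))
        _ = ℓ * (ρ ^ 2 * (1 - etaTail (s * ρ))) := by ring
        _ < _ := by gcongr
    filter_upwards [hlim.eventually_lt_const hlt, self_mem_nhdsWithin,
      Ioc_mem_nhdsGT (show 0 < 2 / Lam ^ 2 by positivity)] with δ h1 hδ hδ2
    have hδ0 : 0 < δ := hδ
    have hδL : δ * Lam ^ 2 ≤ 2 := (le_div_iff₀ (by positivity)).1 hδ2.2
    refine le_trans ?_ h1.le
    simp only [Function.comp]
    rw [← volume_Icc_inter_compl_largeSet _ (by positivity) j]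
    refine volume_le_of_subset_image (f := f) (by positivity)
      (fun u hu v hv => hLip u hu.1 v hv.1) ?_ (hAfin _)
    rintro x ⟨hx1, hx2⟩
    obtain ⟨u, hu, rfl⟩ := himg hx1
    refine ⟨u, ⟨hu, ?_⟩, rfl⟩
    have hq := le_qMin_moebius he he1 hc hlam hδ0 hδL (hbd u hu)
    have hx2' : Real.sqrt δ * qMin (f u) δ ≤ s := not_lt.1 hx2
    change ¬ (s * ρ < Real.sqrt (δ * Lam ^ 2) * _)
    rw [not_lt, Real.sqrt_mul hδ0.le, Real.sqrt_sq hL0.le]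
    calc Real.sqrt δ * Lam * qMin u (δ * Lam ^ 2)
        = ρ * (Real.sqrt δ * (lam * qMin u (δ * Lam ^ 2))) := by rw [hρ]; field_simp
      _ ≤ ρ * (Real.sqrt δ * qMin (f u) δ) := by gcongr
      _ ≤ s * ρ := by rw [mul_comm s]; gcongr
  filter_upwards [hV, hW, self_mem_nhdsWithin] with δ h1 h2 hδ
  have hδ0 : 0 < δ := hδ
  rw [abs_discrepancy s hδ0]
  change |(volume (uIcc (f j) (f (j + 1)) ∩ largeSet s δ)).toReal - ℓ * etaTail s| ≤ κ * ℓ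
  have h3 : (volume (uIcc (f j) (f (j + 1)) ∩ largeSet s δ)).toReal +
      (volume (uIcc (f j) (f (j + 1)) ∩ (largeSet s δ)ᶜ)).toReal = ℓ := by
    have h := measureReal_inter_add_sdiff (μ := volume) (s := uIcc (f j) (f (j + 1)))
      (measurableSet_largeSet (s := s) hδ0) (by simp [uIcc])
    rw [sdiff_eq] at h
    simp only [Measure.real] at h
    rw [h, Real.volume_interval, ENNReal.toReal_ofReal (abs_nonneg _)]
  rw [abs_le]
  constructor <;> linarith

/-- Far from the pole the distortion of `[j, j + 1]` under unimodular maps is uniformly small. -/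
theorem exists_forall_eventually_discrepancy_le {s κ : ℝ} (hs : 0 < s) (hκ : 0 < κ) :
    ∃ N : ℕ, ∀ j : ℕ, N ≤ j → ∀ a b c d e : ℤ, a * d - b * c = e → |e| = 1 → 0 < c → 0 < d →
      ∀ᶠ δ in 𝓝[>] (0 : ℝ), |discrepancy s δ ((a * j + b) / (c * j + d))
        ((a * (j + 1) + b) / (c * (j + 1) + d))| ≤
        κ * |((a * (j + 1) + b) / (c * (j + 1) + d) - (a * j + b) / (c * j + d) : ℝ)| := by
  have hsq : Tendsto (fun ρ : ℝ => ρ ^ 2) (𝓝 1) (𝓝 (1 ^ 2)) := Continuous.tendsto (by fun_prop) 1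
  have h1 : Tendsto (fun ρ : ℝ => ρ ^ 2 * etaTail (s / ρ)) (𝓝 1) (𝓝 (etaTail s)) := by
    have hc : ContinuousAt (fun ρ : ℝ => etaTail (s / ρ)) 1 := by
      refine ContinuousAt.comp (f := fun ρ : ℝ => s / ρ) (g := etaTail) ?_
        (continuousAt_const.div continuousAt_id one_ne_zero)
      rw [div_one]; exact continuousAt_etaTail hs
    have := hsq.mul hc.tendsto
    simpa using this
  have h2 : Tendsto (fun ρ : ℝ => ρ ^ 2 * (1 - etaTail (s * ρ))) (𝓝 1) (𝓝 (1 - etaTail s)) := by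
    have hc : ContinuousAt (fun ρ : ℝ => etaTail (s * ρ)) 1 := by
      refine ContinuousAt.comp (f := fun ρ : ℝ => s * ρ) (g := etaTail) ?_
        (continuousAt_const.mul continuousAt_id)
      rw [mul_one]; exact continuousAt_etaTail hs
    have := hsq.mul (hc.tendsto.const_sub 1)
    simpa using this
  have h3 := (h1.eventually_lt_const (show etaTail s < etaTail s + κ by linarith)).and
    (h2.eventually_lt_const (show 1 - etaTail s < 1 - etaTail s + κ by linarith))
  obtain ⟨r, hr, hball⟩ := Metric.eventually_nhds_iff.1 h3
  obtain ⟨N, hN⟩ := exists_nat_gt (3 / r)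
  refine ⟨N + 2, fun j hj a b c d e he he1 hc hd => ?_⟩
  have hc' : (1 : ℝ) ≤ c := by exact_mod_cast hc
  have hd' : (1 : ℝ) ≤ d := by exact_mod_cast hd
  have hj' : (N : ℝ) + 2 ≤ j := by exact_mod_cast hj
  have hN0 : (0 : ℝ) ≤ N := Nat.cast_nonneg N
  have hlam : (0 : ℝ) < c * (j - 1) + d := by nlinarith
  have hρ : dist (((c : ℝ) * (j + 2) + d) / (c * (j - 1) + d)) 1 < r := by
    rw [Real.dist_eq, div_sub_one hlam.ne', abs_div, abs_of_pos hlam, div_lt_iff₀ hlam,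
      abs_of_nonneg (by nlinarith)]
    have : 3 < r * N := by rw [div_lt_iff₀ hr] at hN; linarith
    have h5 : 3 * (c : ℝ) < r * N * c := by nlinarith
    have h6 : r * (N * c) ≤ r * (c * (j - 1) + d) := by
      gcongr
      nlinarith
    nlinarith
  obtain ⟨hG1, hG2⟩ := hball hρ
  have := eventually_abs_discrepancy_image_le (j := (j : ℤ)) he he1 hc.le hs hlam
    (by push_cast; ring) (by push_cast; ring) hG1 hG2
  simpa using this

/-! ### Equidistribution on subintervals -/

/-- `p / q` and `p' / q'`, in either order, are fractions with positive denominators and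
determinant `±1`, so they are the end points of an interval of the Farey tessellation. -/
def FareyPair (p p' q q' : ℤ) : Prop := 0 < q ∧ 0 < q' ∧ |p' * q - p * q'| = 1

theorem FareyPair.symm {p p' q q' : ℤ} (h : FareyPair p p' q q') : FareyPair p' p q' q :=
  ⟨h.2.1, h.1, by rw [abs_sub_comm]; exact h.2.2⟩

theorem FareyPair.abs_sub {p p' q q' : ℤ} (h : FareyPair p p' q q') :
    |(p' : ℝ) / q' - p / q| = 1 / (q * q') := by
  obtain ⟨h1, h2, h3⟩ := h
  have h1' : (0 : ℝ) < q := by exact_mod_cast h1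
  have h2' : (0 : ℝ) < q' := by exact_mod_cast h2
  have h3' : |(p' : ℝ) * q - p * q'| = 1 := by exact_mod_cast h3
  rw [div_sub_div _ _ h2'.ne' h1'.ne', abs_div, abs_of_pos (mul_pos h2' h1'), mul_comm (q : ℝ),
    mul_comm (q' : ℝ) p, h3']

/-- On every Farey interval the discrepancy is asymptotically at most `θ` times the length. -/
def DiscrepancyBound (s θ : ℝ) : Prop :=
  ∀ p p' q q' : ℤ, FareyPair p p' q q' → ∀ θ' > θ,
    ∀ᶠ δ in 𝓝[>] (0 : ℝ), |discrepancy s δ (p / q) (p' / q')| ≤ θ' * (1 / (q * q'))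

theorem discrepancyBound_one {s : ℝ} (hs : 0 < s) : DiscrepancyBound s 1 := by
  intro p p' q q' h θ' hθ
  refine Eventually.of_forall fun δ => (abs_discrepancy_le hs δ _ _).trans ?_
  rw [h.abs_sub]
  have h1 : (0 : ℝ) < q := by exact_mod_cast h.1
  have h2 : (0 : ℝ) < q' := by exact_mod_cast h.2.1
  exact le_mul_of_one_le_left (by positivity) hθ.le

theorem eventually_abs_discrepancy_chain_le {s t : ℝ} (X Y : ℕ → ℝ) {m n : ℕ} (hmn : m ≤ n)
    (h : ∀ j, m ≤ j → j < n →
      ∀ᶠ δ in 𝓝[>] (0 : ℝ), |discrepancy s δ (X j) (X (j + 1))| ≤ t * (Y j - Y (j + 1))) :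
    ∀ᶠ δ in 𝓝[>] (0 : ℝ), |discrepancy s δ (X m) (X n)| ≤ t * (Y m - Y n) := by
  induction n, hmn using Nat.le_induction with
  | base => simp [discrepancy]
  | succ n hmn ih =>
    filter_upwards [ih fun j h1 h2 => h j h1 (by omega), h n hmn (by omega),
      self_mem_nhdsWithin] with δ h1 h2 hδ
    rw [← discrepancy_add s hδ (X m) (X n) (X (n + 1))]
    calc _ ≤ _ := abs_add_le _ _
      _ ≤ t * (Y m - Y n) + t * (Y n - Y (n + 1)) := add_le_add h1 h2
      _ = _ := by ring

/-- A Farey interval with end points `b / d` and `a / c`, `c ≤ d`, is cut at the points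
`(a j + b) / (c j + d)`. All pieces are Farey intervals, and on the pieces with `N ≤ j < N + d`,
which make up at least the fraction `1 / ((N + 1) (N + 2))` of the interval, the discrepancy is at
most `κ` times the length. -/
theorem DiscrepancyBound.eventually_le {s θ κ : ℝ} (hs : 0 < s) (hκ : 0 < κ) (hκθ : κ ≤ θ)
    (h : DiscrepancyBound s θ) : ∃ r : ℝ, 0 < r ∧ r < 1 ∧ ∀ a b c d : ℤ, FareyPair b a d c →
      c ≤ d → ∀ θ' > θ, ∀ᶠ δ in 𝓝[>] (0 : ℝ),
        |discrepancy s δ (b / d) (a / c)| ≤ (θ' - (θ' - κ) * r) * (1 / (d * c)) := by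
  obtain ⟨N, hN⟩ := exists_forall_eventually_discrepancy_le hs hκ
  refine ⟨1 / ((N + 1) * (N + 2)), by positivity, ?_, ?_⟩
  · rw [div_lt_one (by positivity)]
    have : (0 : ℝ) ≤ N := Nat.cast_nonneg N
    nlinarith
  intro a b c d hp hcd θ' hθ'
  obtain ⟨hd, hc, hdet⟩ := hp
  have hc0 : (0 : ℝ) < c := by exact_mod_cast hc
  have hd0 : (0 : ℝ) < d := by exact_mod_cast hd
  have hc1 : (1 : ℝ) ≤ c := by exact_mod_cast hc
  have hd1 : (1 : ℝ) ≤ d := by exact_mod_cast hd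
  have hcd' : (c : ℝ) ≤ d := by exact_mod_cast hcd
  obtain ⟨D, hD⟩ := Int.eq_ofNat_of_zero_le hd.le
  have hD' : (D : ℝ) = d := by rw [hD]; simp
  set X : ℕ → ℝ := fun j => (a * j + b) / (c * j + d) with hX
  set Y : ℕ → ℝ := fun j => 1 / (c * (c * j + d)) with hY
  have hden : ∀ j : ℕ, (0 : ℝ) < c * j + d := fun j => by positivity
  have hpair : ∀ j : ℕ, FareyPair (a * j + b) (a * (j + 1) + b) (c * j + d) (c * (j + 1) + d) := by
    intro j
    refine ⟨by positivity, by positivity, ?_⟩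
    refine Eq.trans ?_ hdet; congr 1; ring
  have hlen : ∀ j : ℕ, (1 : ℝ) / ((c * j + d) * (c * (j + 1) + d)) = Y j - Y (j + 1) := by
    intro j
    have h1 := hden j
    have h2 := hden (j + 1)
    simp only [hY]
    push_cast at h2 ⊢
    field_simp
    ring
  have hall : ∀ j : ℕ, ∀ᶠ δ in 𝓝[>] (0 : ℝ),
      |discrepancy s δ (X j) (X (j + 1))| ≤ θ' * (Y j - Y (j + 1)) := by
    intro j
    have := h _ _ _ _ (hpair j) θ' hθ'
    rw [← hlen]
    simp only [hX]
    push_cast at this ⊢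
    exact this
  have hgood : ∀ j : ℕ, N ≤ j → ∀ᶠ δ in 𝓝[>] (0 : ℝ),
      |discrepancy s δ (X j) (X (j + 1))| ≤ κ * (Y j - Y (j + 1)) := by
    intro j hj
    have h1 := hN j hj a b c d _ rfl (by rw [← hdet]) hc hd
    have h2 := (hpair j).abs_sub
    push_cast at h2
    rw [h2] at h1
    rw [← hlen]
    simp only [hX]
    push_cast
    exact h1
  have e1 := eventually_abs_discrepancy_chain_le X Y (Nat.zero_le N) fun j _ _ => hall j
  have e2 := eventually_abs_discrepancy_chain_le X Y (Nat.le_add_right N D)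
    fun j hj _ => hgood j hj
  have hlast : FareyPair (a * (N + D : ℕ) + b) a (c * (N + D : ℕ) + d) c := by
    refine ⟨by positivity, hc, ?_⟩
    refine Eq.trans ?_ hdet; congr 1; ring
  have e3 : ∀ᶠ δ in 𝓝[>] (0 : ℝ),
      |discrepancy s δ (X (N + D)) (a / c)| ≤ θ' * Y (N + D) := by
    have := h _ _ _ _ hlast θ' hθ'
    simp only [hX, hY]
    push_cast at this ⊢
    rwa [mul_comm (c : ℝ) (c * _ + _)]
  have hX0 : X 0 = b / d := by simp [hX]
  have hY0 : Y 0 = 1 / (d * c) := by simp [hY, mul_comm]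
  have hprop : 1 / ((N + 1) * (N + 2)) * Y 0 ≤ Y N - Y (N + D) := by
    have hN0 : (0 : ℝ) ≤ N := Nat.cast_nonneg N
    have h1 : Y N - Y (N + D) = d / ((c * N + d) * (c * (N + d) + d)) := by
      have h2 := hden N
      have h3 := hden (N + D)
      simp only [hY]
      push_cast at h3 ⊢
      rw [hD'] at h3 ⊢
      field_simp
      ring
    have h4 : (1 : ℝ) / ((N + 1) * (N + 2)) * Y 0 = d / (d * (N + 1) * (c * d * (N + 2))) := by
      rw [hY0]; field_simp
    rw [h1, h4]
    have h5 : (c : ℝ) * N + d ≤ d * (N + 1) := by nlinarith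
    have h6 : (c : ℝ) * (N + d) + d ≤ c * d * (N + 2) := by
      have : (c : ℝ) * N ≤ c * N * d := le_mul_of_one_le_right (by positivity) hd1
      have : (d : ℝ) ≤ c * d := le_mul_of_one_le_left hd0.le hc1
      nlinarith
    have h7 := hden N
    gcongr
  filter_upwards [e1, e2, e3, self_mem_nhdsWithin] with δ h1 h2 h3 hδ
  have hδ0 : 0 < δ := hδ
  rw [hX0] at h1
  rw [← discrepancy_add s hδ0 (b / d) (X N) (a / c),
    ← discrepancy_add s hδ0 (X N) (X (N + D)) (a / c), ← hY0]
  have h4 := abs_add_le (discrepancy s δ (b / d) (X N))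
    (discrepancy s δ (X N) (X (N + D)) + discrepancy s δ (X (N + D)) (a / c))
  have h5 := abs_add_le (discrepancy s δ (X N) (X (N + D))) (discrepancy s δ (X (N + D)) (a / c))
  have h6 : (θ' - κ) * (1 / ((N + 1) * (N + 2)) * Y 0) ≤ (θ' - κ) * (Y N - Y (N + D)) :=
    mul_le_mul_of_nonneg_left hprop (by linarith)
  linarith

/-- Applying the bound to the pieces of a Farey interval improves the constant. -/
theorem DiscrepancyBound.improve {s θ κ : ℝ} (hs : 0 < s) (hκ : 0 < κ) (hκθ : κ < θ)
    (h : DiscrepancyBound s θ) : ∃ θ₁, 0 ≤ θ₁ ∧ θ₁ < θ ∧ DiscrepancyBound s θ₁ := by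
  obtain ⟨r, hr0, hr1, hr⟩ := h.eventually_le hs hκ hκθ.le
  refine ⟨θ - (θ - κ) * r, by nlinarith, by nlinarith, fun p p' q q' hp θ' hθ' => ?_⟩
  have hq : (0 : ℝ) < q := by exact_mod_cast hp.1
  have hq' : (0 : ℝ) < q' := by exact_mod_cast hp.2.1
  set t := θ' - (θ - (θ - κ) * r) with ht
  have ht0 : 0 < t := by linarith
  have hle : (θ + t) - ((θ + t) - κ) * r ≤ θ' := by nlinarith
  rcases le_total q' q with hqq | hqq
  · filter_upwards [hr p' p q' q hp hqq (θ + t) (by linarith)] with δ hδ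
    refine hδ.trans ?_
    gcongr
  · filter_upwards [hr p p' q q' hp.symm hqq (θ + t) (by linarith)] with δ hδ
    rw [discrepancy_symm, abs_neg]
    refine hδ.trans ?_
    rw [mul_comm (q : ℝ)]
    gcongr

/-- The infimum of the admissible constants is admissible, so it cannot be improved, hence is
`0`. -/
theorem discrepancyBound_zero {s : ℝ} (hs : 0 < s) : DiscrepancyBound s 0 := by
  set S : Set ℝ := {θ | 0 ≤ θ ∧ DiscrepancyBound s θ} with hS
  have hne : S.Nonempty := ⟨1, zero_le_one, discrepancyBound_one hs⟩
  have hbdd : BddBelow S := ⟨0, fun _ h => h.1⟩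
  have hmem : DiscrepancyBound s (sInf S) := by
    intro p p' q q' hp θ' hθ'
    obtain ⟨θ, hθ, hlt⟩ := exists_lt_of_csInf_lt hne hθ'
    exact hθ.2 p p' q q' hp θ' hlt
  have h0 : 0 ≤ sInf S := le_csInf hne fun _ h => h.1
  rcases h0.eq_or_lt with h | h
  · rwa [← h] at hmem
  · obtain ⟨θ₁, h1, h2, h3⟩ := hmem.improve hs (half_pos h) (half_lt_self h)
    exact absurd (csInf_le hbdd ⟨h1, h3⟩) (not_le.2 h2)

theorem FareyPair.tendsto_discrepancy {s : ℝ} (hs : 0 < s) {p p' q q' : ℤ}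
    (h : FareyPair p p' q q') :
    Tendsto (fun δ => discrepancy s δ (p / q) (p' / q')) (𝓝[>] 0) (𝓝 0) := by
  have hq : (0 : ℝ) < q := by exact_mod_cast h.1
  have hq' : (0 : ℝ) < q' := by exact_mod_cast h.2.1
  rw [Metric.tendsto_nhds]
  intro ε hε
  filter_upwards [discrepancyBound_zero hs p p' q q' h (ε / 2 * (q * q')) (by positivity)] with δ hδ
  rw [Real.dist_eq, sub_zero]
  refine hδ.trans_lt ?_
  field_simp
  linarith

theorem tendsto_discrepancy_trans {s a b c : ℝ}
    (h1 : Tendsto (fun δ => discrepancy s δ a b) (𝓝[>] 0) (𝓝 0))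
    (h2 : Tendsto (fun δ => discrepancy s δ b c) (𝓝[>] 0) (𝓝 0)) :
    Tendsto (fun δ => discrepancy s δ a c) (𝓝[>] 0) (𝓝 0) := by
  have h := h1.add h2
  rw [add_zero] at h
  refine h.congr' ?_
  filter_upwards [self_mem_nhdsWithin] with δ hδ using discrepancy_add s hδ a b c

theorem tendsto_discrepancy_intCast {s : ℝ} (hs : 0 < s) (n : ℤ) :
    Tendsto (fun δ => discrepancy s δ 0 n) (𝓝[>] 0) (𝓝 0) := by
  have hstep : ∀ m n : ℤ, |n - m| = 1 →
      Tendsto (fun δ => discrepancy s δ m n) (𝓝[>] 0) (𝓝 0) := by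
    intro m n hmn
    have h : FareyPair m n 1 1 := ⟨one_pos, one_pos, by simpa using hmn⟩
    simpa using h.tendsto_discrepancy hs
  induction n using Int.induction_on with
  | zero => simp [discrepancy]
  | succ n ih => exact tendsto_discrepancy_trans ih (hstep _ _ (by simp))
  | pred n ih =>
    refine tendsto_discrepancy_trans ih (hstep _ _ ?_)
    rw [show -(n : ℤ) - 1 - -n = -1 by ring]; rfl

/-- Every reduced fraction with denominator `q > 1` forms a Farey pair with one of smaller
denominator. -/
theorem tendsto_discrepancy_div {s : ℝ} (hs : 0 < s) (q : ℕ) : ∀ p : ℤ, 0 < q →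
    IsCoprime p (q : ℤ) → Tendsto (fun δ => discrepancy s δ 0 (p / q)) (𝓝[>] 0) (𝓝 0) := by
  induction q using Nat.strong_induction_on with
  | _ q ih =>
    intro p hq hcop
    rcases (Nat.succ_le_of_lt hq).eq_or_lt with h1 | h1
    · rw [← h1]; simpa using tendsto_discrepancy_intCast hs p
    obtain ⟨x, y, hxy⟩ := hcop
    have hq0 : (0 : ℤ) < q := by exact_mod_cast hq
    have hmod := Int.emod_add_mul_ediv x q
    have hx0 := Int.emod_nonneg x hq0.ne'
    have hx1 := Int.emod_lt_of_pos x hq0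
    set r := x % q
    set k := x / q
    have hdet : p * r - -(y + p * k) * q = 1 := by linear_combination hxy + p * hmod
    obtain ⟨n, hn⟩ := Int.eq_ofNat_of_zero_le hx0
    have hn0 : 0 < n := by
      rcases Nat.eq_zero_or_pos n with h | h
      · exfalso
        rw [hn, h] at hdet
        have : (q : ℤ) ∣ 1 := ⟨y + p * k, by push_cast at hdet; linarith⟩
        have := Int.le_of_dvd one_pos this
        omega
      · exact h
    rw [hn] at hdet hx1
    have hpair : FareyPair (-(y + p * k)) p n q :=
      ⟨by exact_mod_cast hn0, hq0, by rw [hdet, abs_one]⟩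
    have hih := ih n (by exact_mod_cast hx1) (-(y + p * k)) hn0
      ⟨-q, p, by linear_combination hdet⟩
    have := tendsto_discrepancy_trans hih (by simpa using hpair.tendsto_discrepancy hs)
    simpa using this

theorem tendsto_discrepancy_zero {s : ℝ} (hs : 0 < s) (b : ℝ) :
    Tendsto (fun δ => discrepancy s δ 0 b) (𝓝[>] 0) (𝓝 0) := by
  rw [Metric.tendsto_nhds]
  intro ε hε
  obtain ⟨r, h1, h2⟩ := exists_rat_btwn (show b < b + ε / 2 by linarith)
  have hr : Tendsto (fun δ => discrepancy s δ 0 r) (𝓝[>] 0) (𝓝 0) := by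
    rw [Rat.cast_def]
    exact tendsto_discrepancy_div hs r.den r.num r.pos r.isCoprime_num_den
  filter_upwards [Metric.tendsto_nhds.1 hr (ε / 2) (by linarith), self_mem_nhdsWithin]
    with δ hδ hδ0
  rw [Real.dist_eq, sub_zero] at hδ ⊢
  rw [← discrepancy_add s hδ0 0 r b]
  have h3 := abs_discrepancy_le hs δ r b
  rw [abs_of_nonpos (by linarith : b - (r : ℝ) ≤ 0)] at h3
  have := abs_add_le (discrepancy s δ 0 r) (discrepancy s δ r b)
  linarith

/-- The limiting distribution of the normalised smallest denominator on every subinterval of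
`[0, 1]`. -/
theorem tendsto_volume_inter_largeSet {s : ℝ} (hs : 0 < s) {D : Set ℝ} (hD : D.OrdConnected)
    (hD01 : D ⊆ Icc 0 1) :
    Tendsto (fun δ => (volume (D ∩ largeSet s δ)).toReal) (𝓝[>] 0)
      (𝓝 ((volume D).toReal * etaTail s)) := by
  rcases D.eq_empty_or_nonempty with rfl | hne
  · simp
  have hbb : BddBelow D := bddBelow_Icc.mono hD01
  have hba : BddAbove D := bddAbove_Icc.mono hD01
  set a := sInf D
  set b := sSup D
  have hab : a ≤ b := csInf_le_csSup hne hbb hba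
  have hsub : D ⊆ Icc a b := fun x hx => ⟨csInf_le hbb hx, le_csSup hba hx⟩
  have hsup : Ioo a b ⊆ D := by
    rintro x ⟨h1, h2⟩
    obtain ⟨y, hy, hyx⟩ := exists_lt_of_csInf_lt hne h1
    obtain ⟨z, hz, hxz⟩ := exists_lt_of_lt_csSup hne h2
    exact hD.out hy hz ⟨hyx.le, hxz.le⟩
  have hae : D =ᵐ[volume] Icc a b :=
    (LE.le.eventuallyLE hsub).antisymm
      (Ioo_ae_eq_Icc.symm.le.trans (LE.le.eventuallyLE hsup))
  have h1 := tendsto_discrepancy_trans (a := a) (b := 0) (c := b)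
    (by
      have := (tendsto_discrepancy_zero hs a).neg
      rw [neg_zero] at this
      exact this.congr fun δ => (discrepancy_symm s δ 0 a).symm)
    (tendsto_discrepancy_zero hs b)
  have h2 := h1.add_const ((b - a) * etaTail s)
  rw [zero_add] at h2
  rw [measure_congr hae, Real.volume_Icc, ENNReal.toReal_ofReal (sub_nonneg.2 hab)]
  refine h2.congr' ?_
  filter_upwards [self_mem_nhdsWithin] with δ hδ
  rw [discrepancy_of_le s hδ hab, measure_congr (hae.inter (ae_eq_refl (largeSet s δ)))]
  ring

/-! ### Complex moments from tails -/

/-- The tail function `ν(s, ∞)` for `s > 1`, `-ν(-∞, s]` for `s ≤ 1`, that represents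
`∫ (f(y) - f(1)) dν(y)` as an integral against `f'`. -/
noncomputable def signedTail (ν : Measure ℝ) (s : ℝ) : ℝ :=
  if 1 < s then ν.real (Ioi s) else -ν.real (Iic s)

/-- The majorant of `α s ^ (α - 1) * signedTail ν s`. -/
noncomputable def momentBound (α : ℂ) (C s : ℝ) : ℝ :=
  ‖α‖ * s ^ (α.re - 1) * (C * if 1 < s then s ^ (-2 : ℝ) else s ^ (2 : ℝ))

theorem integrableOn_momentBound {α : ℂ} (hα : |α.re| < 2) (C : ℝ) :
    IntegrableOn (momentBound α C) (Ioi 0) := by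
  rw [abs_lt] at hα
  rw [← Ioc_union_Ioi_eq_Ioi (zero_le_one (α := ℝ))]
  refine IntegrableOn.union ?_ ?_
  · have h : IntegrableOn (fun s : ℝ => ‖α‖ * C * s ^ (α.re + 1)) (Ioc 0 1) :=
      ((intervalIntegrable_iff_integrableOn_Ioc_of_le zero_le_one).1
        (intervalIntegral.intervalIntegrable_rpow' (by linarith))).const_mul _
    refine h.congr_fun (fun s hs => ?_) measurableSet_Ioc
    simp only [momentBound]
    rw [if_neg (not_lt.2 hs.2), show α.re + 1 = (α.re - 1) + 2 by ring, Real.rpow_add hs.1]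
    ring
  · have h : IntegrableOn (fun s : ℝ => ‖α‖ * C * s ^ (α.re - 3)) (Ioi 1) :=
      (integrableOn_Ioi_rpow_of_lt (by linarith) one_pos).const_mul _
    refine h.congr_fun (fun s hs => ?_) measurableSet_Ioi
    simp only [momentBound]
    rw [if_pos (show 1 < s from hs), show α.re - 3 = (α.re - 1) + -2 by ring,
      Real.rpow_add (one_pos.trans hs)]
    ring

theorem abs_signedTail_le {ν : Measure ℝ} {C : ℝ} (h1 : ∀ s > 0, ν.real (Ioi s) ≤ C / s ^ 2)
    (h2 : ∀ s > 0, ν.real (Iic s) ≤ C * s ^ 2) {s : ℝ} (hs : 0 < s) :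
    |signedTail ν s| ≤ C * if 1 < s then s ^ (-2 : ℝ) else s ^ (2 : ℝ) := by
  have e2 : s ^ (2 : ℝ) = s ^ 2 := by norm_cast
  rw [signedTail]
  split_ifs with h
  · rw [abs_of_nonneg measureReal_nonneg, Real.rpow_neg hs.le, e2, ← div_eq_mul_inv]
    exact h1 s hs
  · rw [abs_neg, abs_of_nonneg measureReal_nonneg, e2]
    exact h2 s hs

theorem norm_mul_cpow (α : ℂ) {s : ℝ} (hs : 0 < s) :
    ‖α * (s : ℂ) ^ (α - 1)‖ = ‖α‖ * s ^ (α.re - 1) := by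
  rw [norm_mul, Complex.norm_cpow_eq_rpow_re_of_pos hs]; simp

theorem integral_mul_cpow (α : ℂ) {y : ℝ} (hy : 0 < y) :
    ∫ s in (1 : ℝ)..y, α * (s : ℂ) ^ (α - 1) = (y : ℂ) ^ α - 1 := by
  rcases eq_or_ne α 0 with rfl | hα
  · simp
  have h0 : (0 : ℝ) ∉ uIcc 1 y := fun h => absurd ((le_inf zero_le_one hy.le).antisymm h.1)
    (by rcases le_total 1 y with h | h <;> simp [h]; exact hy.ne)
  rw [intervalIntegral.integral_const_mul, integral_cpow (Or.inr ⟨fun h => hα (by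
    linear_combination h), h0⟩), sub_add_cancel]
  simp [mul_div_cancel₀ _ hα]

/-- The kernel of the layer-cake representation `y ^ α - 1 = ∫ α s ^ (α - 1) k(y, s) ds`. -/
noncomputable def momentKernel (α : ℂ) (p : ℝ × ℝ) : ℂ :=
  α * (p.2 : ℂ) ^ (α - 1) *
    ((if 1 < p.2 ∧ p.2 < p.1 then 1 else 0) - if p.2 ≤ 1 ∧ p.1 ≤ p.2 then 1 else 0)

theorem measurable_momentKernel (α : ℂ) : Measurable (momentKernel α) := by
  unfold momentKernel
  refine Measurable.mul (by fun_prop) (Measurable.sub ?_ ?_)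
  · exact Measurable.ite ((measurableSet_lt measurable_const measurable_snd).inter
      (measurableSet_lt measurable_snd measurable_fst)) measurable_const measurable_const
  · exact Measurable.ite ((measurableSet_le measurable_snd measurable_const).inter
      (measurableSet_le measurable_fst measurable_snd)) measurable_const measurable_const

theorem integral_momentKernel_snd (α : ℂ) {y : ℝ} (hy : 0 < y) :
    ∫ s in Ioi (0 : ℝ), momentKernel α (y, s) = (y : ℂ) ^ α - 1 := by
  have hint : ∀ a b : ℝ, 0 < a → IntegrableOn (fun s : ℝ => α * (s : ℂ) ^ (α - 1)) (Icc a b) := by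
    intro a b ha
    refine ContinuousOn.integrableOn_Icc (continuousOn_const.mul ?_)
    exact ContinuousOn.cpow_const (by fun_prop) fun s hs =>
      Complex.ofReal_mem_slitPlane.2 (ha.trans_le hs.1)
  have h : ∀ s ∈ Ioi (0 : ℝ), momentKernel α (y, s) =
      (Ioo 1 y).indicator (fun s : ℝ => α * (s : ℂ) ^ (α - 1)) s -
        (Icc y 1).indicator (fun s : ℝ => α * (s : ℂ) ^ (α - 1)) s := by
    intro s _
    simp only [momentKernel, indicator_apply, mem_Ioo, mem_Icc, mul_sub, mul_ite, mul_one, mul_zero]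
    congr 1
    exact if_congr and_comm rfl rfl
  rw [setIntegral_congr_fun measurableSet_Ioi h, integral_sub, setIntegral_indicator
    measurableSet_Ioo, setIntegral_indicator measurableSet_Icc, inter_eq_right.2
    (show Ioo 1 y ⊆ Ioi 0 from fun s hs => one_pos.trans hs.1), inter_eq_right.2
    (show Icc y 1 ⊆ Ioi 0 from fun s hs => hy.trans_le hs.1),
    ← integral_mul_cpow α hy, intervalIntegral, integral_Ioc_eq_integral_Ioo,
    integral_Icc_eq_integral_Ioc]
  · rw [integrable_indicator_iff measurableSet_Ioo]
    exact ((hint 1 y one_pos).mono_set Ioo_subset_Icc_self).mono_measure Measure.restrict_le_self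
  · rw [integrable_indicator_iff measurableSet_Icc]
    exact (hint y 1 hy).mono_measure Measure.restrict_le_self

theorem momentKernel_of_one_lt (α : ℂ) {s : ℝ} (hs : 1 < s) (y : ℝ) :
    momentKernel α (y, s) = (Ioi s).indicator (fun _ => α * (s : ℂ) ^ (α - 1)) y := by
  simp [momentKernel, indicator_apply, hs, not_le.2 hs]

theorem momentKernel_of_le_one (α : ℂ) {s : ℝ} (hs : s ≤ 1) (y : ℝ) :
    momentKernel α (y, s) = (Iic s).indicator (fun _ => -(α * (s : ℂ) ^ (α - 1))) y := by
  simp [momentKernel, indicator_apply, hs, not_lt.2 hs]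
  split_ifs <;> simp

theorem integral_momentKernel_fst (α : ℂ) (ν : Measure ℝ) (s : ℝ) :
    ∫ y, momentKernel α (y, s) ∂ν = α * (s : ℂ) ^ (α - 1) * signedTail ν s := by
  rcases lt_or_ge 1 s with hs | hs
  · simp_rw [momentKernel_of_one_lt α hs]
    rw [integral_indicator_const _ measurableSet_Ioi, signedTail, if_pos hs, Complex.real_smul,
      mul_comm]
  · simp_rw [momentKernel_of_le_one α hs]
    rw [integral_indicator_const _ measurableSet_Iic, signedTail, if_neg (not_lt.2 hs),
      Complex.real_smul]
    push_cast; ring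

theorem integral_norm_momentKernel (α : ℂ) (ν : Measure ℝ) (s : ℝ) :
    ∫ y, ‖momentKernel α (y, s)‖ ∂ν = ‖α * (s : ℂ) ^ (α - 1)‖ * |signedTail ν s| := by
  rcases lt_or_ge 1 s with hs | hs
  · simp_rw [momentKernel_of_one_lt α hs, norm_indicator_eq_indicator_norm]
    rw [integral_indicator_const _ measurableSet_Ioi, signedTail, if_pos hs, smul_eq_mul,
      abs_of_nonneg measureReal_nonneg, mul_comm]
  · simp_rw [momentKernel_of_le_one α hs, norm_indicator_eq_indicator_norm, norm_neg]
    rw [integral_indicator_const _ measurableSet_Iic, signedTail, if_neg (not_lt.2 hs), smul_eq_mul,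
      abs_neg, abs_of_nonneg measureReal_nonneg, mul_comm]

theorem integrable_momentKernel {α : ℂ} (hα : |α.re| < 2) {ν : Measure ℝ} [IsFiniteMeasure ν]
    {C : ℝ} (h1 : ∀ s > 0, ν.real (Ioi s) ≤ C / s ^ 2)
    (h2 : ∀ s > 0, ν.real (Iic s) ≤ C * s ^ 2) :
    Integrable (momentKernel α) (ν.prod (volume.restrict (Ioi 0))) := by
  rw [integrable_prod_iff' (measurable_momentKernel α).aestronglyMeasurable]
  constructor
  · refine Eventually.of_forall fun s => ?_
    rcases lt_or_ge 1 s with hs | hs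
    · simp_rw [momentKernel_of_one_lt α hs]
      exact (integrable_const _).indicator measurableSet_Ioi
    · simp_rw [momentKernel_of_le_one α hs]
      exact (integrable_const _).indicator measurableSet_Iic
  · refine Integrable.mono' (integrableOn_momentBound hα C) ?_ ?_
    · exact (measurable_momentKernel α).norm.aestronglyMeasurable.prod_swap.integral_prod_right'
    · filter_upwards [ae_restrict_mem measurableSet_Ioi] with s hs
      have hs0 : 0 < s := hs
      rw [integral_norm_momentKernel, Real.norm_eq_abs, abs_mul, abs_abs, abs_norm,
        norm_mul_cpow α hs0, momentBound]
      gcongr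
      exact abs_signedTail_le h1 h2 hs0

/-- Complex moments of a measure on `(0, ∞)` in terms of its tails. -/
theorem integral_cpow_eq {α : ℂ} (hα : |α.re| < 2) {ν : Measure ℝ} [IsFiniteMeasure ν]
    (h0 : ∀ᵐ y ∂ν, 0 < y) {C : ℝ} (h1 : ∀ s > 0, ν.real (Ioi s) ≤ C / s ^ 2)
    (h2 : ∀ s > 0, ν.real (Iic s) ≤ C * s ^ 2) :
    Integrable (fun y : ℝ => (y : ℂ) ^ α) ν ∧
      IntegrableOn (fun s : ℝ => α * (s : ℂ) ^ (α - 1) * signedTail ν s) (Ioi 0) ∧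
      ∫ y, (y : ℂ) ^ α ∂ν = ν.real univ +
        ∫ s in Ioi (0 : ℝ), α * (s : ℂ) ^ (α - 1) * signedTail ν s := by
  have hK := integrable_momentKernel hα h1 h2
  have hae : (fun y : ℝ => (∫ s in Ioi (0 : ℝ), momentKernel α (y, s)) + 1) =ᵐ[ν]
      fun y : ℝ => (y : ℂ) ^ α := by
    filter_upwards [h0] with y hy
    rw [integral_momentKernel_snd α hy]; ring
  have hl := hK.integral_prod_left
  have hr := hK.integral_prod_right
  simp_rw [integral_momentKernel_fst] at hr
  refine ⟨(hl.add (integrable_const 1)).congr hae, hr, ?_⟩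
  rw [← integral_congr_ae hae, integral_add hl (integrable_const 1),
    integral_integral_swap (f := fun y s => momentKernel α (y, s)) hK]
  simp_rw [integral_momentKernel_fst]
  simp [add_comm]

/-- Convergence of complex moments from convergence of the tails and uniform tail bounds. -/
theorem tendsto_integral_signedTail {α : ℂ} (hα : |α.re| < 2) {ι : Type*} {l : Filter ι}
    [l.IsCountablyGenerated] {ν : ι → Measure ℝ} {T : ℝ → ℝ} {C : ℝ}
    (h0 : ∀ᶠ i in l, IntegrableOn (fun s : ℝ => α * (s : ℂ) ^ (α - 1) * signedTail (ν i) s) (Ioi 0))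
    (h1 : ∀ᶠ i in l, ∀ s > 0, (ν i).real (Ioi s) ≤ C / s ^ 2)
    (h2 : ∀ᶠ i in l, ∀ s > 0, (ν i).real (Iic s) ≤ C * s ^ 2)
    (hT : ∀ s > 0, Tendsto (fun i => signedTail (ν i) s) l (𝓝 (T s))) :
    Tendsto (fun i => ∫ s in Ioi (0 : ℝ), α * (s : ℂ) ^ (α - 1) * signedTail (ν i) s) l
      (𝓝 (∫ s in Ioi (0 : ℝ), α * (s : ℂ) ^ (α - 1) * T s)) := by
  refine tendsto_integral_filter_of_dominated_convergence (momentBound α C) ?_ ?_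
    (integrableOn_momentBound hα C) ?_
  · filter_upwards [h0] with i hi using hi.aestronglyMeasurable
  · filter_upwards [h1, h2] with i hi1 hi2
    filter_upwards [ae_restrict_mem measurableSet_Ioi] with s hs
    have hs0 : 0 < s := hs
    rw [norm_mul, norm_mul_cpow α hs0, momentBound, Complex.norm_real, Real.norm_eq_abs]
    gcongr
    exact abs_signedTail_le hi1 hi2 hs0
  · filter_upwards [ae_restrict_mem measurableSet_Ioi] with s hs
    exact (Complex.continuous_ofReal.tendsto _ |>.comp (hT s hs)).const_mul _

/-! ### The moments of the smallest denominator -/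

theorem measurable_sqrt_mul_qMin {δ : ℝ} (hδ : 0 < δ) :
    Measurable fun x : ℝ => Real.sqrt δ * qMin x δ :=
  measurable_of_Ioi fun _ => measurableSet_largeSet hδ

theorem measurable_qMin {δ : ℝ} (hδ : 0 < δ) : Measurable fun x : ℝ => (qMin x δ : ℝ) := by
  have h := (measurable_sqrt_mul_qMin hδ).const_mul (Real.sqrt δ)⁻¹
  have hs := (Real.sqrt_pos.2 hδ).ne'
  simpa [inv_mul_cancel_left₀ hs] using h

theorem measurable_qMin_cpow {δ : ℝ} (hδ : 0 < δ) (α : ℂ) :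
    Measurable fun x : ℝ => (qMin x δ : ℂ) ^ α := by
  have h : Measurable fun x : ℝ => (((qMin x δ : ℝ) : ℂ)) ^ α :=
    (Complex.measurable_ofReal.comp (measurable_qMin hδ)).pow_const α
  simpa using h

theorem exists_qMin_le {δ : ℝ} (hδ : 0 < δ) : ∃ n : ℕ, ∀ x, qMin x δ ≤ n := by
  obtain ⟨n, hn⟩ := exists_nat_gt (1 / δ)
  have hn0 : (0 : ℝ) < n := lt_trans (by positivity) hn
  rw [div_lt_iff₀ hδ] at hn
  refine ⟨n, fun x => Nat.sInf_le ⟨by exact_mod_cast hn0, ⌊(n : ℝ) * (x - δ / 2)⌋ + 1, ?_, ?_⟩⟩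
  · rw [lt_div_iff₀ hn0, mul_comm]; push_cast; exact Int.lt_floor_add_one _
  · rw [div_lt_iff₀ hn0]; push_cast
    have := Int.floor_le ((n : ℝ) * (x - δ / 2))
    nlinarith

theorem integrableOn_qMin_cpow {δ : ℝ} (hδ : 0 < δ) (α : ℂ) {D : Set ℝ} (hD01 : D ⊆ Icc 0 1) :
    IntegrableOn (fun x : ℝ => (qMin x δ : ℂ) ^ α) D := by
  obtain ⟨n, hn⟩ := exists_qMin_le hδ
  refine IntegrableOn.mono_set ?_ hD01
  refine Measure.integrableOn_of_bounded (M := (n : ℝ) ^ |α.re|) (by simp)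
    (measurable_qMin_cpow hδ α).aestronglyMeasurable (Eventually.of_forall fun x => ?_)
  have h0 : 0 < qMin x δ := (isLeast_qMin x hδ).1.1
  have h1 : (1 : ℝ) ≤ qMin x δ := by exact_mod_cast h0
  have h2 : (qMin x δ : ℝ) ≤ n := by exact_mod_cast hn x
  rw [Complex.norm_natCast_cpow_of_pos h0]
  calc (qMin x δ : ℝ) ^ α.re ≤ (qMin x δ : ℝ) ^ |α.re| :=
        Real.rpow_le_rpow_of_exponent_le h1 (le_abs_self _)
    _ ≤ _ := Real.rpow_le_rpow (by positivity) h2 (abs_nonneg _)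

/-- The probability measure on `(0, ∞)` with density `η`. -/
noncomputable def etaMeasure : Measure ℝ :=
  (volume.restrict (Ioi 0)).withDensity fun s => ((eta s).toNNReal : ENNReal)

theorem measurable_toNNReal_eta : Measurable fun s => (eta s).toNNReal :=
  measurable_eta.real_toNNReal

theorem etaMeasure_apply {S : Set ℝ} (hS : MeasurableSet S) (h : S ⊆ Ioi 0) :
    etaMeasure S = ENNReal.ofReal (∫ s in S, eta s) := by
  rw [etaMeasure, withDensity_apply _ hS, Measure.restrict_restrict hS, inter_eq_left.2 h]
  refine (ofReal_integral_eq_lintegral_ofReal (integrableOn_eta.mono_set h) ?_).symm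
  filter_upwards [ae_restrict_mem hS] with s hs
  exact eta_nonneg (le_of_lt (h hs))

theorem etaMeasure_Iic_zero : etaMeasure (Iic 0) = 0 := by
  rw [etaMeasure, withDensity_apply _ measurableSet_Iic,
    Measure.restrict_restrict measurableSet_Iic,
    (Iic_disjoint_Ioi (a := (0 : ℝ)) le_rfl).inter_eq]
  simp

theorem etaMeasure_Ioi_zero : etaMeasure (Ioi 0) = 1 := by
  rw [etaMeasure_apply measurableSet_Ioi subset_rfl, integral_eta, ENNReal.ofReal_one]

instance isProbabilityMeasure_etaMeasure : IsProbabilityMeasure etaMeasure := by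
  constructor
  rw [← Iic_union_Ioi (a := (0 : ℝ)), measure_union (Iic_disjoint_Ioi le_rfl) measurableSet_Ioi,
    etaMeasure_Iic_zero, etaMeasure_Ioi_zero, zero_add]

theorem etaMeasure_real_Ioi {s : ℝ} (hs : 0 < s) : etaMeasure.real (Ioi s) = etaTail s := by
  rw [Measure.real, etaMeasure_apply measurableSet_Ioi (Ioi_subset_Ioi hs.le), ← etaTail,
    ENNReal.toReal_ofReal (etaTail_nonneg hs)]

theorem etaMeasure_real_Iic {s : ℝ} (hs : 0 < s) : etaMeasure.real (Iic s) = 1 - etaTail s := by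
  rw [← etaMeasure_real_Ioi hs, ← compl_Ioi, probReal_compl_eq_one_sub measurableSet_Ioi]

theorem integral_cpow_etaMeasure {α : ℂ} (hα : |α.re| < 2) :
    IntegrableOn (fun s : ℝ => (s : ℂ) ^ α * (eta s : ℂ)) (Ioi 0) ∧
      momentM α = 1 +
        ∫ s in Ioi (0 : ℝ), α * (s : ℂ) ^ (α - 1) * signedTail etaMeasure s := by
  have h0 : ∀ᵐ y ∂etaMeasure, 0 < y := by
    rw [ae_iff]
    have : {y : ℝ | ¬ 0 < y} = Iic 0 := by ext; simp
    rw [this, etaMeasure_Iic_zero]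
  obtain ⟨h1, -, h3⟩ := integral_cpow_eq hα h0 (C := 8)
    (fun s hs => (etaMeasure_real_Ioi hs).trans_le (etaTail_le_inv_sq hs)) (fun s hs => by
      rw [etaMeasure_real_Iic hs]
      nlinarith [one_sub_sq_le_etaTail hs])
  have hcongr : ∀ s ∈ Ioi (0 : ℝ), (eta s).toNNReal • (s : ℂ) ^ α = (s : ℂ) ^ α * (eta s : ℂ) := by
    intro s hs
    rw [NNReal.smul_def, Real.coe_toNNReal _ (eta_nonneg (le_of_lt hs)), Complex.real_smul,
      mul_comm]
  constructor
  · rw [etaMeasure, integrable_withDensity_iff_integrable_smul measurable_toNNReal_eta] at h1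
    exact IntegrableOn.congr_fun h1 hcongr measurableSet_Ioi
  · rw [momentM, ← setIntegral_congr_fun measurableSet_Ioi hcongr,
      ← integral_withDensity_eq_integral_smul measurable_toNNReal_eta]
    change ∫ s, (s : ℂ) ^ α ∂etaMeasure = _
    rw [h3]
    simp

/-- The distribution of the normalised smallest denominator on `D`. -/
noncomputable def qMinMeasure (D : Set ℝ) (δ : ℝ) : Measure ℝ :=
  (volume.restrict D).map fun x => Real.sqrt δ * qMin x δ

theorem qMinMeasure_real_Ioi {D : Set ℝ} {δ : ℝ} (hδ : 0 < δ) (s : ℝ) :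
    (qMinMeasure D δ).real (Ioi s) = (volume (D ∩ largeSet s δ)).toReal := by
  rw [Measure.real, qMinMeasure, Measure.map_apply (measurable_sqrt_mul_qMin hδ) measurableSet_Ioi]
  change (volume.restrict D (largeSet s δ)).toReal = _
  rw [Measure.restrict_apply (measurableSet_largeSet hδ), inter_comm]

theorem qMinMeasure_real_Iic {D : Set ℝ} {δ : ℝ} (hδ : 0 < δ) (s : ℝ) :
    (qMinMeasure D δ).real (Iic s) = (volume (D ∩ (largeSet s δ)ᶜ)).toReal := by
  rw [Measure.real, qMinMeasure, Measure.map_apply (measurable_sqrt_mul_qMin hδ) measurableSet_Iic]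
  have : (fun x : ℝ => Real.sqrt δ * qMin x δ) ⁻¹' Iic s = (largeSet s δ)ᶜ := by
    ext x; simp [largeSet]
  rw [this, Measure.restrict_apply (measurableSet_largeSet hδ).compl, inter_comm]

theorem qMinMeasure_real_univ {D : Set ℝ} {δ : ℝ} (hδ : 0 < δ) :
    (qMinMeasure D δ).real univ = (volume D).toReal := by
  rw [Measure.real, qMinMeasure, Measure.map_apply (measurable_sqrt_mul_qMin hδ) MeasurableSet.univ]
  simp

theorem ne_top_of_subset_Icc {D S : Set ℝ} (hD01 : D ⊆ Icc 0 1) : volume (D ∩ S) ≠ ⊤ :=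
  ((measure_mono (inter_subset_left.trans hD01)).trans_lt (by simp)).ne

theorem qMinMeasure_real_Ioi_le {D : Set ℝ} (hD01 : D ⊆ Icc 0 1) {δ : ℝ} (hδ : 0 < δ)
    (hδ1 : δ ≤ 1) {s : ℝ} (hs : 0 < s) : (qMinMeasure D δ).real (Ioi s) ≤ 8 / s ^ 2 := by
  rw [qMinMeasure_real_Ioi hδ]
  refine le_trans ?_ (volume_largeSet_le_inv_sq hs hδ hδ1)
  have h := volume_Icc_inter_largeSet s δ 0
  simp only [Int.cast_zero, zero_add] at h
  rw [← h]
  exact ENNReal.toReal_mono (ne_top_of_subset_Icc subset_rfl)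
    (measure_mono (inter_subset_inter_left _ hD01))

theorem qMinMeasure_real_Iic_le {D : Set ℝ} (hD01 : D ⊆ Icc 0 1) {δ : ℝ} (hδ : 0 < δ)
    {s : ℝ} (hs : 0 < s) : (qMinMeasure D δ).real (Iic s) ≤ 8 * s ^ 2 := by
  rw [qMinMeasure_real_Iic hδ]
  have h := volume_Icc_inter_compl_largeSet s hδ 0
  simp only [Int.cast_zero, zero_add] at h
  have h2 := one_sub_sq_le_volume_largeSet hs hδ
  have h3 : (volume (D ∩ (largeSet s δ)ᶜ)).toReal ≤ (volume (Icc 0 1 ∩ (largeSet s δ)ᶜ)).toReal :=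
    ENNReal.toReal_mono (ne_top_of_subset_Icc subset_rfl)
      (measure_mono (inter_subset_inter_left _ hD01))
  nlinarith

theorem tendsto_signedTail_qMinMeasure {D : Set ℝ} (hD : D.OrdConnected) (hD01 : D ⊆ Icc 0 1)
    {s : ℝ} (hs : 0 < s) : Tendsto (fun δ => signedTail (qMinMeasure D δ) s) (𝓝[>] 0)
      (𝓝 ((volume D).toReal * signedTail etaMeasure s)) := by
  have h := tendsto_volume_inter_largeSet hs hD hD01
  simp only [signedTail, etaMeasure_real_Ioi hs, etaMeasure_real_Iic hs]
  split_ifs with h1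
  · refine h.congr' ?_
    filter_upwards [self_mem_nhdsWithin] with δ hδ using (qMinMeasure_real_Ioi hδ s).symm
  · have h2 := h.sub_const (volume D).toReal
    rw [show (volume D).toReal * -(1 - etaTail s) =
      (volume D).toReal * etaTail s - (volume D).toReal by ring]
    refine h2.congr' ?_
    filter_upwards [self_mem_nhdsWithin] with δ hδ
    have hδ0 : 0 < δ := hδ
    have hD' : volume D ≠ ⊤ := by simpa using ne_top_of_subset_Icc (S := univ) hD01
    have h3 := measureReal_inter_add_sdiff (μ := volume) (s := D)
      (measurableSet_largeSet (s := s) hδ0) hD'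
    rw [sdiff_eq] at h3
    rw [qMinMeasure_real_Iic hδ0]
    simp only [Measure.real] at h3
    linarith

theorem integral_qMin_cpow_eq {D : Set ℝ} {δ : ℝ} (hδ : 0 < δ) (α : ℂ) :
    (δ : ℂ) ^ (α / 2) * ∫ x in D, (qMin x δ : ℂ) ^ α = ∫ y, (y : ℂ) ^ α ∂(qMinMeasure D δ) := by
  rw [qMinMeasure, integral_map (measurable_sqrt_mul_qMin hδ).aemeasurable
    (Measurable.aestronglyMeasurable (Complex.measurable_ofReal.pow_const α)),
    ← integral_const_mul]
  congr 1
  ext x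
  have hsq : ((Real.sqrt δ : ℝ) : ℂ) ^ α = (δ : ℂ) ^ (α / 2) := by
    have hd : (δ : ℂ) ≠ 0 := by exact_mod_cast hδ.ne'
    have hr : ((Real.sqrt δ : ℝ) : ℂ) ≠ 0 := by exact_mod_cast (Real.sqrt_pos.2 hδ).ne'
    rw [Complex.cpow_def_of_ne_zero hr, Complex.cpow_def_of_ne_zero hd,
      ← Complex.ofReal_log (Real.sqrt_nonneg _), ← Complex.ofReal_log hδ.le, Real.log_sqrt hδ.le]
    congr 1
    push_cast; ring
  rw [Complex.ofReal_mul, Complex.mul_cpow_ofReal_nonneg (Real.sqrt_nonneg _) (by positivity), hsq]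
  simp

theorem tendsto_integral_qMin_cpow {D : Set ℝ} (hD : D.OrdConnected) (hD01 : D ⊆ Icc 0 1) {α : ℂ}
    (hα : |α.re| < 2) :
    Tendsto (fun δ : ℝ => (δ : ℂ) ^ (α / 2) * ∫ x in D, (qMin x δ : ℂ) ^ α) (𝓝[>] 0)
      (𝓝 (((volume D).toReal : ℂ) * momentM α)) := by
  have hfin : ∀ δ, IsFiniteMeasure (qMinMeasure D δ) := by
    intro δ
    have : IsFiniteMeasure (volume.restrict D) := ⟨by
      simpa [lt_top_iff_ne_top] using ne_top_of_subset_Icc (S := univ) hD01⟩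
    unfold qMinMeasure
    infer_instance
  have hpos : ∀ δ > 0, ∀ᵐ y ∂(qMinMeasure D δ), 0 < y := by
    intro δ hδ
    rw [qMinMeasure, ae_map_iff (measurable_sqrt_mul_qMin hδ).aemeasurable measurableSet_Ioi]
    refine Eventually.of_forall fun x => mul_pos (Real.sqrt_pos.2 hδ) ?_
    exact_mod_cast (isLeast_qMin x hδ).1.1
  have hsmall : ∀ᶠ δ in 𝓝[>] (0 : ℝ), δ ∈ Ioc (0 : ℝ) 1 := Ioc_mem_nhdsGT zero_lt_one
  have hmom := fun δ (hδ : δ ∈ Ioc (0 : ℝ) 1) => integral_cpow_eq hα (hpos δ hδ.1) (C := 8)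
    (fun s hs => qMinMeasure_real_Ioi_le hD01 hδ.1 hδ.2 hs)
    (fun s hs => qMinMeasure_real_Iic_le hD01 hδ.1 hs)
  have hlim := tendsto_integral_signedTail hα (l := 𝓝[>] (0 : ℝ)) (ν := qMinMeasure D)
    (C := 8) (T := fun s => (volume D).toReal * signedTail etaMeasure s)
    (hsmall.mono fun δ hδ => (hmom δ hδ).2.1)
    (hsmall.mono fun δ hδ s hs => qMinMeasure_real_Ioi_le hD01 hδ.1 hδ.2 hs)
    (hsmall.mono fun δ hδ s hs => qMinMeasure_real_Iic_le hD01 hδ.1 hs)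
    (fun s hs => tendsto_signedTail_qMinMeasure hD hD01 hs)
  have hval : ((volume D).toReal : ℂ) * momentM α = ((volume D).toReal : ℂ) +
      ∫ s in Ioi (0 : ℝ), α * (s : ℂ) ^ (α - 1) *
        (((volume D).toReal * signedTail etaMeasure s : ℝ) : ℂ) := by
    rw [(integral_cpow_etaMeasure hα).2, mul_add, mul_one, ← integral_const_mul]
    congr 2
    ext s
    push_cast; ring
  rw [hval]
  refine (hlim.const_add ((volume D).toReal : ℂ)).congr' ?_
  filter_upwards [hsmall] with δ hδ
  rw [integral_qMin_cpow_eq hδ.1, (hmom δ hδ).2.2, qMinMeasure_real_univ hδ.1]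

theorem proposition1p2 (D : Set ℝ) (hD : D.OrdConnected) (hD01 : D ⊆ Icc (0 : ℝ) 1) :
    (∀ α : ℂ, |α.re| < 2 →
      (∀ δ : ℝ, 0 < δ → IntegrableOn (fun x : ℝ => (qMin x δ : ℂ) ^ α) D volume) ∧
      IntegrableOn (fun s : ℝ => (s : ℂ) ^ α * (eta s : ℂ)) (Ioi (0 : ℝ)) volume ∧
      Tendsto (fun δ : ℝ => (δ : ℂ) ^ (α / 2) * ∫ x in D, (qMin x δ : ℂ) ^ α)
        (𝓝[>] (0 : ℝ)) (𝓝 (((volume D).toReal : ℂ) * momentM α))) ∧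
    momentM 1 = 16 / (Real.pi : ℂ) ^ 2 :=
  ⟨fun α hα => ⟨fun _ hδ => integrableOn_qMin_cpow hδ α hD01, (integral_cpow_etaMeasure hα).1,
    tendsto_integral_qMin_cpow hD hD01 hα⟩, momentM_one⟩
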